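/- \textbf{Setting.} Let $(\mathbb X,\mathcal F,\mu)$ be a measured space and, for densities $g,g'$ with respect to $\mu$, let $h^2(g,g')=\frac12\int(\sqrt g-\sqrt{g'})^2\,d\mu$ (squared Hellinger distance), $h=\sqrt{h^2}$. Let $n\ge 1$ and let $X_1,\dots,X_n$ be i.i.d. random variables with values in $\mathbb X$ on a probability space $(\Omega,\mathcal E,\mathbb P)$, whose law has density $s$ with respect to $\mu$. Let $d\ge 1$, let $\Theta=\prod_{j=1}^d[m_j,M_j]$ with $m_j\le M_j$, and let $\mathscr F=\{f_\theta,\ \theta\in\Theta\}$ be a family of densities with respect to $\mu$; put $h^2(s,\mathscr F)=\inf_{\theta\in\Theta}h^2(s,f_\theta)$. Assume that there are positive numbers $\alpha_j,\underline R_j,\overline R_j$ with $$\sup_{1\le j\le d}\underline R_j|\theta_j-\theta'_j|^{\alpha_j}\le h^2(f_\theta,f_{\theta'})\le\sup_{1\le j\le d}\overline R_j|\theta_j-\theta_j'|^{\alpha_j}\qquad\text{for all }\theta,\theta'\in\Theta .$$ \textbf{Test.} For $j\in\{1,\dots,d\}$ let $t_j\in(0,d^{1/\alpha_j}]$ and $\epsilon_j=t_j(\overline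 R_jn)^{-1/\alpha_j}$. Let $\pi(\theta)=\big(m_j+\lfloor(\theta_j-m_j)/\epsilon_j\rfloor\epsilon_j\big)_{1\le j\le d}$ and $T(\theta,\theta')=\overline T(f_{\pi(\theta)},f_{\pi(\theta')})$, where (with $0/0=0$) $$\overline T(g,g')=\frac1n\sum_{i=1}^n\frac{\sqrt{g'(X_i)}-\sqrt{g(X_i)}}{\sqrt{g(X_i)+g'(X_i)}}+\frac12\int_{\mathbb X}\sqrt{g+g'}\,\big(\sqrt{g'}-\sqrt g\big)\,d\mu .$$ \textbf{Parameters.} Let $\bar\kappa=\Big(1+\sqrt{\tfrac{2+\sqrt2}{2-\sqrt2}}\Big)^{-2}$, $\kappa\in(0,\bar\kappa)$ and $\eta_j\in[\epsilon_j,\ d^{1/\alpha_j}(\overline R_jn)^{-1/\alpha_j}]$. For every (non-empty, possibly flat) rectangle $\mathcal C=\prod_j[a_j,b_j]\subset\Theta$, all $\theta\ne\theta'$ in $\mathcal C$ and all $j$, let $\bar r_{\mathcal C,j}(\theta,\theta')$ and $\underline r_{\mathcal C,j}(\theta,\theta')$ be positive numbers such that $$\mathcal C\cap\prod_{j=1}^d\big[\theta_j-\underline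 r_{\mathcal C,j}(\theta,\theta'),\ \theta_j+\bar r_{\mathcal C,j}(\theta,\theta')\big]\subset\big\{\theta''\in\Theta:\ h(f_\theta,f_{\theta''})\le\kappa^{1/2}h(f_\theta,f_{\theta'})\big\},$$ and let $\underline R_{\mathcal C,j}\ge\underline R_j$ be such that $h^2(f_\theta,f_{\theta'})\ge\sup_j\underline R_{\mathcal C,j}|\theta_j-\theta'_j|^{\alpha_j}$ for all $\theta,\theta'\in\mathcal C$. For every $k$ let $\psi_k$ be an injective map from $\{1,\dots,d-1\}$ into $\{1,\dots,d\}\setminus\{k\}$. None of these quantities depends on the observations. \textbf{One step.} A rectangle $\mathcal C=\prod_j[a_j,b_j]$ is replaced by a smaller one as follows. Choose $k$ maximizing $\underline R_{\mathcal C,j}(b_j-a_j)^{\alpha_j}$ over $j$ (any maximizer). Set $\theta=a$, $\theta'=a$ except $\theta'_k=b_k$; $\varepsilon_j=\bar r_{\mathcal C,j}(\theta,\theta')$ and $\varepsilon'_j=\bar r_{\mathcal C,j}(\theta',\theta)$ for $j\ne k$; $\varepsilon_k=\varepsilon'_k=(b_k-a_k)/2$. Then repeat the following passage, in which $T(\theta,\theta')$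 and the radii are computed at the values of $\theta,\theta'$ at the beginning of the passage. (i) If $T(\theta,\theta')\ge0$: replace $\varepsilon_{\psi_k(1)}$ by $\bar r_{\mathcal C,\psi_k(1)}(\theta,\theta')$ and every other $\varepsilon_j$ (including $j=k$) by $\min(\varepsilon_j,\bar r_{\mathcal C,j}(\theta,\theta'))$; let $J=\{1\le i\le d-1:\ \theta_{\psi_k(i)}+\varepsilon_{\psi_k(i)}<b_{\psi_k(i)}\}$; if $J\neq\emptyset$, put $i_0=\min J$, reset $\theta_{\psi_k(i)}$ to $a_{\psi_k(i)}$ for $i<i_0$ and add $\varepsilon_{\psi_k(i_0)}$ to $\theta_{\psi_k(i_0)}$. (ii) If $T(\theta,\theta')\le0$: do the same with $\theta',\varepsilon',J'$ in place of $\theta,\varepsilon,J$ and the radii $\bar r_{\mathcal C,j}(\theta',\theta)$ for $j\ne k$, $\underline r_{\mathcal C,k}(\theta',\theta)$ for $j=k$. Stop after the first passage in which (i) was executed with $J=\emptyset$ or (ii) was executed with $J'=\emptyset$; in the first case replace $a_k$ by $a_k+\varepsilon_k$, in the second replace $b_k$ by $b_k-\varepsilon'_k$ (both if both occur). \textbf{Estimator.}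 Starting from $\Theta$, perform such steps as long as $b_j-a_j>\eta_j$ for some $j$; $\hat\theta$ is the centre $\big(\frac{a_j+b_j}2\big)_{j}$ of the last rectangle. \textbf{Theorem.} There is a number $C>0$, depending only on $\kappa$, $(\overline R_j/\underline R_j)_{1\le j\le d}$, $(\alpha_j)_{1\le j\le d}$ and $(t_j)_{1\le j\le d}$, such that for all $\xi>0$ the estimator $\hat\theta$ (when it is defined, i.e. when the procedure stops) satisfies $$\mathbb P\Big[C\,h^2(s,f_{\hat\theta})\ \ge\ h^2(s,\mathscr F)+\frac dn+\xi\Big]\le e^{-n\xi},$$ the event being that the procedure stops and the inequality in the brackets holds for its output, for some admissible choice of the maximizers $k$. -/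

import Mathlib

open MeasureTheory ProbabilityTheory

noncomputable section

namespace RobustTests

/-! ### Hellinger distance -/

/-- `f` is (a version of) a probability density with respect to `μ`. -/
structure IsDensity {𝕏 : Type*} [MeasurableSpace 𝕏] (μ : Measure 𝕏) (f : 𝕏 → ℝ) : Prop where
  measurable : Measurable f
  nonneg : ∀ x, 0 ≤ f x
  integrable : Integrable f μ
  integral_eq_one : ∫ x, f x ∂μ = 1

/-- The squared Hellinger distance `h²(f, g) = ½ ∫ (√f - √g)² dμ`. -/
def hellingerSq {𝕏 : Type*} [MeasurableSpace 𝕏] (μ : Measure 𝕏) (f g : 𝕏 → ℝ) : ℝ :=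
  (1 / 2) * ∫ x, (√(f x) - √(g x)) ^ 2 ∂μ

/-- The Hellinger distance `h(f, g)`. -/
def hellinger {𝕏 : Type*} [MeasurableSpace 𝕏] (μ : Measure 𝕏) (f g : 𝕏 → ℝ) : ℝ :=
  √(hellingerSq μ f g)

/-! ### Rectangles and the model -/

/-- A rectangle `∏ j, [lo j, hi j]` of `ℝ^d`, given by its two extreme corners. -/
structure Rect (d : ℕ) where
  lo : Fin d → ℝ
  hi : Fin d → ℝ

/-- The set of points `∏ j, [lo j, hi j]`. -/
def Rect.toSet {d : ℕ} (C : Rect d) : Set (Fin d → ℝ) := Set.Icc C.lo C.hi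

/-- The centre of a rectangle. -/
def Rect.center {d : ℕ} (C : Rect d) : Fin d → ℝ := fun j => (C.lo j + C.hi j) / 2

/-- `C` is a (non-empty, possibly flat) rectangle contained in `Θ`. -/
def Rect.IsSubrect {d : ℕ} (C Θ : Rect d) : Prop := C.lo ≤ C.hi ∧ C.toSet ⊆ Θ.toSet

/-- `h²(s, ℱ) = inf_{θ ∈ Θ} h²(s, f_θ)`. -/
def hellingerSqModel {𝕏 : Type*} [MeasurableSpace 𝕏] {d : ℕ} (μ : Measure 𝕏) (s : 𝕏 → ℝ)
    (f : (Fin d → ℝ) → 𝕏 → ℝ) (Θ : Rect d) : ℝ :=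
  sInf ((fun θ => hellingerSq μ s (f θ)) '' Θ.toSet)

/-- The Hellinger ball `ℬ(θ, r) = {θ' ∈ Θ, h(f_θ, f_θ') ≤ r}`. -/
def hellingerBall {𝕏 : Type*} [MeasurableSpace 𝕏] {d : ℕ} (μ : Measure 𝕏)
    (f : (Fin d → ℝ) → 𝕏 → ℝ) (Θ : Rect d) (θ : Fin d → ℝ) (r : ℝ) : Set (Fin d → ℝ) :=
  {θ' | θ' ∈ Θ.toSet ∧ hellinger μ (f θ) (f θ') ≤ r}

/-- The two-sided Hölder-type bounds on the Hellinger distance: for all `θ, θ' ∈ Θ`,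
`sup_j Rlo_j |θ_j - θ'_j|^{α_j} ≤ h²(f_θ, f_θ') ≤ sup_j Rhi_j |θ_j - θ'_j|^{α_j}`. -/
def HolderHellinger {𝕏 : Type*} [MeasurableSpace 𝕏] {d : ℕ} (μ : Measure 𝕏)
    (f : (Fin d → ℝ) → 𝕏 → ℝ) (Θ : Rect d) (α Rlo Rhi : Fin d → ℝ) : Prop :=
  ∀ θ ∈ Θ.toSet, ∀ θ' ∈ Θ.toSet,
    (⨆ j, Rlo j * |θ j - θ' j| ^ α j) ≤ hellingerSq μ (f θ) (f θ') ∧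
    hellingerSq μ (f θ) (f θ') ≤ ⨆ j, Rhi j * |θ j - θ' j| ^ α j

/-! ### The test -/

/-- The functional `T̄(g, g')` evaluated at the sample `x`; as usual in Lean, `0 / 0 = 0`. -/
def testFunctional {𝕏 : Type*} [MeasurableSpace 𝕏] {n : ℕ} (μ : Measure 𝕏) (x : Fin n → 𝕏)
    (g g' : 𝕏 → ℝ) : ℝ :=
  (1 / (n : ℝ)) * ∑ i, (√(g' (x i)) - √(g (x i))) / √(g (x i) + g' (x i))
    + (1 / 2) * ∫ y, √(g y + g' y) * (√(g' y) - √(g y)) ∂μ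

/-- The projection `π` on the grid of origin `m` and steps `ε_j`. -/
def gridProj {d : ℕ} (m ε : Fin d → ℝ) (θ : Fin d → ℝ) : Fin d → ℝ :=
  fun j => m j + (⌊(θ j - m j) / ε j⌋ : ℝ) * ε j

/-- The test `T(θ, θ') = T̄(f_{π(θ)}, f_{π(θ')})`. -/
def test {𝕏 : Type*} [MeasurableSpace 𝕏] {n d : ℕ} (μ : Measure 𝕏) (f : (Fin d → ℝ) → 𝕏 → ℝ)
    (Θ : Rect d) (ε : Fin d → ℝ) (x : Fin n → 𝕏) (θ θ' : Fin d → ℝ) : ℝ :=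
  testFunctional μ x (f (gridProj Θ.lo ε θ)) (f (gridProj Θ.lo ε θ'))

/-- `κ̄ = (1 + √((2 + √2) / (2 - √2)))⁻²`. -/
def kappaBar : ℝ := ((1 + √((2 + √2) / (2 - √2))) ^ 2)⁻¹

/-! ### The quantities chosen by the statistician -/

/-- For each rectangle `C`, each `j` and `θ, θ' ∈ C`: the numbers `rUp C j θ θ'` (`r̄_{C,j}(θ, θ')`),
`rDown C j θ θ'` (`r̲_{C,j}(θ, θ')`) and `Rloc C j` (`R̲_{C,j}`); for each `k`, an enumeration
`ψ k` of the coordinates other than `k` (the first index is `0`). -/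
structure Tuning (d : ℕ) where
  rUp : Rect d → Fin d → (Fin d → ℝ) → (Fin d → ℝ) → ℝ
  rDown : Rect d → Fin d → (Fin d → ℝ) → (Fin d → ℝ) → ℝ
  Rloc : Rect d → Fin d → ℝ
  ψ : Fin d → Fin (d - 1) → Fin d

/-- The conditions that these quantities have to satisfy. -/
structure Tuning.Admissible {𝕏 : Type*} [MeasurableSpace 𝕏] {d : ℕ} (p : Tuning d)
    (μ : Measure 𝕏) (f : (Fin d → ℝ) → 𝕏 → ℝ) (Θ : Rect d) (α Rlo : Fin d → ℝ) (κ : ℝ) :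
    Prop where
  rUp_pos : ∀ C : Rect d, C.IsSubrect Θ → ∀ θ ∈ C.toSet, ∀ θ' ∈ C.toSet, θ ≠ θ' →
    ∀ j, 0 < p.rUp C j θ θ'
  rDown_pos : ∀ C : Rect d, C.IsSubrect Θ → ∀ θ ∈ C.toSet, ∀ θ' ∈ C.toSet, θ ≠ θ' →
    ∀ j, 0 < p.rDown C j θ θ'
  inter_subset_ball : ∀ C : Rect d, C.IsSubrect Θ → ∀ θ ∈ C.toSet, ∀ θ' ∈ C.toSet, θ ≠ θ' →
    C.toSet ∩ Set.Icc (fun j => θ j - p.rDown C j θ θ') (fun j => θ j + p.rUp C j θ θ')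
      ⊆ hellingerBall μ f Θ θ (√κ * hellinger μ (f θ) (f θ'))
  le_Rloc : ∀ C : Rect d, C.IsSubrect Θ → ∀ j, Rlo j ≤ p.Rloc C j
  Rloc_le : ∀ C : Rect d, C.IsSubrect Θ → ∀ θ ∈ C.toSet, ∀ θ' ∈ C.toSet,
    (⨆ j, p.Rloc C j * |θ j - θ' j| ^ α j) ≤ hellingerSq μ (f θ) (f θ')
  ψ_injective : ∀ k, Function.Injective (p.ψ k)
  ψ_ne : ∀ k i, p.ψ k i ≠ k

/-! ### Construction of a rectangle from the preceding one

Below, `C` is the current rectangle, `k` the coordinate along which it is to be shortened, and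
`T` the test (for the observed sample). -/

/-- The variables of the `repeat` loop: `θ, θ'` and the vectors `(ε_j)`, `(ε'_j)`. -/
structure LoopState (d : ℕ) where
  θ : Fin d → ℝ
  θ' : Fin d → ℝ
  ε : Fin d → ℝ
  ε' : Fin d → ℝ

open Classical in
/-- The values of the variables before the `repeat` loop. -/
def initState {d : ℕ} (p : Tuning d) (C : Rect d) (k : Fin d) : LoopState d where
  θ := C.lo
  θ' := Function.update C.lo k (C.hi k)
  ε := fun j => if j = k then (C.hi k - C.lo k) / 2
    else p.rUp C j C.lo (Function.update C.lo k (C.hi k))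
  ε' := fun j => if j = k then (C.hi k - C.lo k) / 2
    else p.rUp C j (Function.update C.lo k (C.hi k)) C.lo

open Classical in
/-- Update of the side lengths: the one in the coordinate `ψ_k(first)` is replaced by the new radius,
those in the other coordinates (`k` included) by the minimum of the old value and the new radius. -/
def updateEps {d : ℕ} (p : Tuning d) (k : Fin d) (r ε : Fin d → ℝ) : Fin d → ℝ :=
  fun j => if ∃ i : Fin (d - 1), (i : ℕ) = 0 ∧ p.ψ k i = j then r j else min (ε j) (r j)

open Classical in
/-- The indices `i` such that `θ_{ψ_k(i)} + ε_{ψ_k(i)} < b_{ψ_k(i)}`. -/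
def movable {d : ℕ} (p : Tuning d) (C : Rect d) (k : Fin d) (θ ε : Fin d → ℝ) :
    Finset (Fin (d - 1)) :=
  Finset.univ.filter fun i => θ (p.ψ k i) + ε (p.ψ k i) < C.hi (p.ψ k i)

open Classical in
/-- Displacement of `θ`: with `i₀` the least movable index, the coordinates `ψ_k(i)`, `i < i₀`, are
reset to those of the lower corner and `ε` is added to the coordinate `ψ_k(i₀)`.
Nothing is moved when no index is movable. -/
def advance {d : ℕ} (p : Tuning d) (C : Rect d) (k : Fin d) (θ ε : Fin d → ℝ) : Fin d → ℝ :=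
  if h : (movable p C k θ ε).Nonempty then
    fun j =>
      if ∃ i, i < (movable p C k θ ε).min' h ∧ p.ψ k i = j then C.lo j
      else if j = p.ψ k ((movable p C k θ ε).min' h) then θ j + ε j
      else θ j
  else θ

open Classical in
/-- The vector `ε` after the first conditional block of one passage in the loop. -/
def nextEps {d : ℕ} (T : (Fin d → ℝ) → (Fin d → ℝ) → ℝ) (p : Tuning d) (C : Rect d) (k : Fin d)
    (S : LoopState d) : Fin d → ℝ :=
  if 0 ≤ T S.θ S.θ' then updateEps p k (fun j => p.rUp C j S.θ S.θ') S.ε else S.ε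

open Classical in
/-- The vector `ε'` after the second conditional block of one passage in the loop. -/
def nextEps' {d : ℕ} (T : (Fin d → ℝ) → (Fin d → ℝ) → ℝ) (p : Tuning d) (C : Rect d) (k : Fin d)
    (S : LoopState d) : Fin d → ℝ :=
  if T S.θ S.θ' ≤ 0 then
    updateEps p k (fun j => if j = k then p.rDown C j S.θ' S.θ else p.rUp C j S.θ' S.θ) S.ε'
  else S.ε'

open Classical in
/-- The variables after one passage in the loop. -/
def nextState {d : ℕ} (T : (Fin d → ℝ) → (Fin d → ℝ) → ℝ) (p : Tuning d) (C : Rect d) (k : Fin d)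
    (S : LoopState d) : LoopState d where
  θ := if 0 ≤ T S.θ S.θ' then advance p C k S.θ (nextEps T p C k S) else S.θ
  θ' := if T S.θ S.θ' ≤ 0 then advance p C k S.θ' (nextEps' T p C k S) else S.θ'
  ε := nextEps T p C k S
  ε' := nextEps' T p C k S

/-- The first exit condition (`𝔧_min = d`): the first block was executed and found no movable
index. -/
def Exhausted {d : ℕ} (T : (Fin d → ℝ) → (Fin d → ℝ) → ℝ) (p : Tuning d) (C : Rect d) (k : Fin d)
    (S : LoopState d) : Prop :=
  0 ≤ T S.θ S.θ' ∧ ¬ (movable p C k S.θ (nextEps T p C k S)).Nonempty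

/-- The second exit condition (`𝔧'_min = d`). -/
def Exhausted' {d : ℕ} (T : (Fin d → ℝ) → (Fin d → ℝ) → ℝ) (p : Tuning d) (C : Rect d) (k : Fin d)
    (S : LoopState d) : Prop :=
  T S.θ S.θ' ≤ 0 ∧ ¬ (movable p C k S.θ' (nextEps' T p C k S)).Nonempty

open Classical in
/-- The rectangle returned when the loop stops after the passage that started from `S`: `a_k` is
increased by `ε_k` under the first exit condition, `b_k` is decreased by `ε'_k` under the second. -/
def cutRect {d : ℕ} (T : (Fin d → ℝ) → (Fin d → ℝ) → ℝ) (p : Tuning d) (C : Rect d) (k : Fin d)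
    (S : LoopState d) : Rect d where
  lo := if Exhausted T p C k S then
    Function.update C.lo k (C.lo k + nextEps T p C k S k) else C.lo
  hi := if Exhausted' T p C k S then
    Function.update C.hi k (C.hi k - nextEps' T p C k S k) else C.hi

/-- `LoopReturns T p C k S C'`: the loop, started from the variables `S`, stops after finitely many
passages and the rectangle returned is `C'`. -/
inductive LoopReturns {d : ℕ} (T : (Fin d → ℝ) → (Fin d → ℝ) → ℝ) (p : Tuning d) (C : Rect d)
    (k : Fin d) : LoopState d → Rect d → Prop
  | exit (S : LoopState d) (h : Exhausted T p C k S ∨ Exhausted' T p C k S) :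
      LoopReturns T p C k S (cutRect T p C k S)
  | again (S : LoopState d) (C' : Rect d) (h : ¬ (Exhausted T p C k S ∨ Exhausted' T p C k S))
      (h' : LoopReturns T p C k (nextState T p C k S) C') : LoopReturns T p C k S C'

/-- `k` maximises `R̲_{C,j} (b_j - a_j)^{α_j}`; any maximiser may be chosen. -/
def IsSelected {d : ℕ} (α : Fin d → ℝ) (p : Tuning d) (C : Rect d) (k : Fin d) : Prop :=
  ∀ j, p.Rloc C j * (C.hi j - C.lo j) ^ α j ≤ p.Rloc C k * (C.hi k - C.lo k) ^ α k

/-! ### The whole procedure -/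

/-- `RunReturns T α η p C C'`: starting with the current rectangle `C`, the `while` loop stops and
`C'` is the last rectangle built. -/
inductive RunReturns {d : ℕ} (T : (Fin d → ℝ) → (Fin d → ℝ) → ℝ) (α η : Fin d → ℝ)
    (p : Tuning d) : Rect d → Rect d → Prop
  | finish (C : Rect d) (h : ∀ j, C.hi j - C.lo j ≤ η j) : RunReturns T α η p C C
  | step (C C' C'' : Rect d) (k : Fin d) (h : ∃ j, η j < C.hi j - C.lo j)
      (hk : IsSelected α p C k) (hC' : LoopReturns T p C k (initState p C k) C')
      (h' : RunReturns T α η p C' C'') : RunReturns T α η p C C''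

/-- `θhat` is the output of the procedure on the sample `x`: the centre of the last rectangle of a
run started from `Θ`. -/
def IsEstimate {𝕏 : Type*} [MeasurableSpace 𝕏] {n d : ℕ} (μ : Measure 𝕏)
    (f : (Fin d → ℝ) → 𝕏 → ℝ) (Θ : Rect d) (ε α η : Fin d → ℝ) (p : Tuning d) (x : Fin n → 𝕏)
    (θhat : Fin d → ℝ) : Prop :=
  ∃ C : Rect d, RunReturns (test μ f Θ ε x) α η p Θ C ∧ θhat = C.center

end RobustTests

end

open RobustTests

/-!
The proof separates one probabilistic event from a deterministic analysis of the procedure.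

*The test.* Completing the square around `√((g + g') / 2)` shows that the mean of the test statistic
of `g` against `g'` is at most `(√2 + 1) h²(s, g) - (√2 - 1) h²(s, g')` (`drift_le`), while the
second moment of its summands, which are bounded by `1`, is at most `6 (h²(s, g) + h²(s, g'))`
(`integral_mul_score_sq_le`). An exponential inequality with parameter `δ / 12` therefore costs only
a small multiple `δ` of the two risks. Half of this slack is spent on the second moment, and the
other half is left as a weight `exp (-const n (h²(s, g) + h²(s, g')))`. Since `n h²` grows at least
like a power of the distance on the grid, counted in grid steps, these weights are summable over the
grid with a sum that depends neither on `n` nor on the size of `Θ` (`sum_exp_neg_le_latticeSum`).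
The union bound (`measure_exists_test_ge_le`) thus holds simultaneously for all pairs of the grid.
On its complement, `T(θ, θ') ≥ 0` implies
`(√2 - 1 - δ) h²(s, f_θ') ≤ (√2 + 1 + δ) h²(s, f_θ) + O(h²(s, ℱ) + d / n + ξ)`. The number `κ̄` is
such that, for `κ < κ̄` and `δ` small, this excludes that `h²(f_θ, f_θ')` is large when the ball of
centre `θ` and radius `√κ h(f_θ, f_θ')` contains a near-minimiser `q` of the risk
(`hellinger_le_of_test_nonneg`).

*The procedure.* Within a step the boxes visited by `θ` (resp. `θ'`) are enumerated in the manner of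
an odometer. The invariant `CoveredBefore` says that they cover all that precedes the current point;
it survives the shrinking of the side lengths because only the first digit may see its step grow.
Hence all points cut off from the rectangle belong to a ball as above
(`LoopReturns.isSubrect_and_discardable`). So either `q` survives until the end, when the rectangle
has Hellinger diameter at most `√(d / n)`, or it is cut off at a step where the compared points are
`O(√(h²(s, ℱ) + d / n + ξ))`-close. As these lie on the two faces orthogonal to the selected
coordinate, the whole current rectangle, which contains the output, then has a diameter of this
order (`RunReturns.hellingerSq_center_le`).
-/

namespace RobustTests

/-! ### The Hellinger distance -/

section Hellinger

variable {𝕏 : Type*} [MeasurableSpace 𝕏] {μ : Measure 𝕏} {f g s : 𝕏 → ℝ}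

theorem hellingerSq_nonneg : 0 ≤ hellingerSq μ f g :=
  mul_nonneg (by norm_num) (integral_nonneg fun _ => sq_nonneg _)

theorem sq_hellinger : hellinger μ f g ^ 2 = hellingerSq μ f g :=
  Real.sq_sqrt hellingerSq_nonneg

theorem hellinger_nonneg : 0 ≤ hellinger μ f g := Real.sqrt_nonneg _

theorem hellingerSq_comm : hellingerSq μ f g = hellingerSq μ g f := by
  unfold hellingerSq
  congr 2
  ext x
  ring

theorem hellinger_comm : hellinger μ f g = hellinger μ g f := by
  unfold hellinger
  rw [hellingerSq_comm]

theorem IsDensity.memLp_sqrt (hf : IsDensity μ f) : MemLp (fun x => √(f x)) 2 μ := by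
  rw [memLp_two_iff_integrable_sq hf.measurable.sqrt.aestronglyMeasurable]
  simpa only [Real.sq_sqrt (hf.nonneg _)] using hf.integrable

theorem norm_toLp_sub (hf : IsDensity μ f) (hg : IsDensity μ g) :
    ‖hf.memLp_sqrt.toLp - hg.memLp_sqrt.toLp‖ = √2 * hellinger μ f g := by
  rw [← MemLp.toLp_sub, Lp.norm_toLp,
    (hf.memLp_sqrt.sub hg.memLp_sqrt).eLpNorm_eq_integral_rpow_norm (by norm_num) (by norm_num),
    ENNReal.toReal_ofReal (by positivity), hellinger, hellingerSq, ← Real.sqrt_mul (by norm_num)]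
  rw [Real.sqrt_eq_rpow, ← mul_assoc]
  norm_num

theorem hellinger_triangle (hf : IsDensity μ f) (hs : IsDensity μ s) (hg : IsDensity μ g) :
    hellinger μ f g ≤ hellinger μ f s + hellinger μ s g := by
  have h := norm_sub_le_norm_sub_add_norm_sub hf.memLp_sqrt.toLp hs.memLp_sqrt.toLp
    hg.memLp_sqrt.toLp
  rw [norm_toLp_sub hf hs, norm_toLp_sub hs hg, norm_toLp_sub hf hg, ← mul_add] at h
  exact le_of_mul_le_mul_left h (by positivity)

/-- The bound `h²(f, g) ≤ 2 h²(s, f) + 2 h²(s, g)`, read as a lower bound for `h²(s, f)`. -/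
theorem half_hellingerSq_sub_le (hf : IsDensity μ f) (hs : IsDensity μ s) (hg : IsDensity μ g) :
    hellingerSq μ f g / 2 - hellingerSq μ s g ≤ hellingerSq μ s f := by
  have h := hellinger_triangle hf hs hg
  rw [hellinger_comm (f := f) (g := s)] at h
  rw [← sq_hellinger (f := f), ← sq_hellinger (f := s), ← sq_hellinger (f := s)]
  nlinarith [sq_nonneg (hellinger μ s f - hellinger μ s g),
    hellinger_nonneg (μ := μ) (f := f) (g := g)]

end Hellinger

/-! ### Mean and second moment of the test statistic -/

/-- The summand `(√g' - √g) / √(g + g')` of the test statistic. -/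
noncomputable def score {𝕏 : Type*} (g g' : 𝕏 → ℝ) (y : 𝕏) : ℝ :=
  (√(g' y) - √(g y)) / √(g y + g' y)

/-- With `a = √g`, `b = √g'`, `u = √s`: the integrand of the mean of the test statistic, after
completing the square around `√((g + g') / 2)`. Concavity of the square root, in the form
`(a + b) / 2 ≤ √((a² + b²) / 2)`, gives the bound. -/
theorem drift_pointwise {u a b : ℝ} (hu : 0 ≤ u) (ha : 0 ≤ a) (hb : 0 ≤ b) :
    u ^ 2 * ((b - a) / √(a ^ 2 + b ^ 2)) + 1 / 2 * (√(a ^ 2 + b ^ 2) * (b - a))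
      ≤ 1 / 2 * ((u - a) ^ 2 + (u - b) ^ 2) + √2 * (u * (b - a)) := by
  have hc : √2 ^ 2 = (2 : ℝ) := Real.sq_sqrt (by norm_num)
  have hc0 : 0 ≤ √(2 : ℝ) := Real.sqrt_nonneg _
  have hQ2 : √(a ^ 2 + b ^ 2) ^ 2 = a ^ 2 + b ^ 2 := Real.sq_sqrt (by positivity)
  have hQ0 : 0 ≤ √(a ^ 2 + b ^ 2) := Real.sqrt_nonneg _
  generalize √(a ^ 2 + b ^ 2) = Q at *
  generalize √(2 : ℝ) = c at *
  rcases hQ0.eq_or_lt with h | hQ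
  · subst h
    have : a = 0 := by nlinarith
    have : b = 0 := by nlinarith
    subst a b
    simp
    positivity
  · obtain ⟨w, hw⟩ : ∃ w, w = (b - a) / Q := ⟨_, rfl⟩
    have hwQ : b - a = w * Q := by rw [hw]; field_simp
    rw [← hw]
    have hw1 : w ≤ 1 := by
      rw [hw, div_le_one hQ]
      nlinarith
    have hab : a + b ≤ c * Q := abs_le_of_sq_le_sq' (by nlinarith [sq_nonneg (a - b)])
      (by positivity) |>.2
    have h1 : w * (1 / 2 * (c * u - Q) ^ 2) ≤ 1 * (1 / 2 * (c * u - Q) ^ 2) :=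
      mul_le_mul_of_nonneg_right hw1 (by positivity)
    have h2 : u * (a + b) ≤ u * (c * Q) := mul_le_mul_of_nonneg_left hab hu
    have h3 : (c * u - Q) ^ 2 = 2 * u ^ 2 - 2 * c * u * Q + Q ^ 2 := by
      linear_combination u ^ 2 * hc
    rw [h3] at h1
    rw [hwQ]
    nlinarith

theorem score_sq_pointwise {u a b : ℝ} (hu : 0 ≤ u) (ha : 0 ≤ a) (hb : 0 ≤ b) :
    u ^ 2 * ((b - a) / √(a ^ 2 + b ^ 2)) ^ 2 ≤ 3 * ((u - a) ^ 2 + (u - b) ^ 2) := by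
  have hc : √2 ^ 2 = (2 : ℝ) := Real.sq_sqrt (by norm_num)
  have hc0 : 0 ≤ √(2 : ℝ) := Real.sqrt_nonneg _
  have hQ2 : √(a ^ 2 + b ^ 2) ^ 2 = a ^ 2 + b ^ 2 := Real.sq_sqrt (by positivity)
  have hQ0 : 0 ≤ √(a ^ 2 + b ^ 2) := Real.sqrt_nonneg _
  generalize √(a ^ 2 + b ^ 2) = Q at *
  generalize √(2 : ℝ) = c at *
  rcases hQ0.eq_or_lt with h | hQ
  · subst h
    simp
    positivity
  · obtain ⟨w, hw⟩ : ∃ w, w = (b - a) / Q := ⟨_, rfl⟩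
    have hwQ : b - a = w * Q := by rw [hw]; field_simp
    rw [← hw]
    have hw1 : w ^ 2 ≤ 1 := by
      rw [hw, div_pow, div_le_one (by positivity)]
      nlinarith [mul_nonneg ha hb]
    have hab : a + b ≤ c * Q := abs_le_of_sq_le_sq' (by nlinarith [sq_nonneg (a - b)])
      (by positivity) |>.2
    have h2 : u * (a + b) ≤ u * (c * Q) := mul_le_mul_of_nonneg_left hab hu
    have h1 : w ^ 2 * (c * u - Q) ^ 2 ≤ 1 * (c * u - Q) ^ 2 :=
      mul_le_mul_of_nonneg_right hw1 (by positivity)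
    have h3 : (c * u - Q) ^ 2 = 2 * u ^ 2 - 2 * c * u * Q + Q ^ 2 := by
      linear_combination u ^ 2 * hc
    -- `u² ≤ (√2 u - Q)² + Q²`, because the difference is `(√2 Q - u)²`
    have h4 : w ^ 2 * u ^ 2 ≤ w ^ 2 * ((c * u - Q) ^ 2 + Q ^ 2) := by
      apply mul_le_mul_of_nonneg_left _ (sq_nonneg w)
      have : (c * Q - u) ^ 2 = 2 * Q ^ 2 - 2 * c * u * Q + u ^ 2 := by
        linear_combination Q ^ 2 * hc
      nlinarith [sq_nonneg (c * Q - u)]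
    have h5 : (b - a) ^ 2 = w ^ 2 * Q ^ 2 := by rw [hwQ]; ring
    nlinarith [sq_nonneg (u - a + (u - b))]

theorem score_swap {𝕏 : Type*} {g g' : 𝕏 → ℝ} (y : 𝕏) : score g' g y = -score g g' y := by
  unfold score
  rw [add_comm (g' y), ← neg_div, neg_sub]

section Moments

variable {𝕏 : Type*} [MeasurableSpace 𝕏] {μ : Measure 𝕏} {g g' s : 𝕏 → ℝ}

theorem measurable_score (hg : IsDensity μ g) (hg' : IsDensity μ g') :
    Measurable (score g g') :=
  (hg'.measurable.sqrt.sub hg.measurable.sqrt).div (hg.measurable.add hg'.measurable).sqrt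

theorem abs_score_le_one (hg : IsDensity μ g) (hg' : IsDensity μ g') (y : 𝕏) :
    |score g g' y| ≤ 1 := by
  unfold score
  rw [abs_div, abs_of_nonneg (Real.sqrt_nonneg (g y + g' y))]
  refine div_le_one_of_le₀ (Real.abs_le_sqrt ?_) (Real.sqrt_nonneg _)
  nlinarith [Real.sq_sqrt (hg.nonneg y), Real.sq_sqrt (hg'.nonneg y),
    mul_nonneg (Real.sqrt_nonneg (g y)) (Real.sqrt_nonneg (g' y))]

theorem integrable_sq_sub (hs : IsDensity μ s) (hg : IsDensity μ g) :
    Integrable (fun y => (√(s y) - √(g y)) ^ 2) μ :=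
  (hs.memLp_sqrt.sub hg.memLp_sqrt).integrable_sq

theorem integral_sq_sub : ∫ y, (√(s y) - √(g y)) ^ 2 ∂μ = 2 * hellingerSq μ s g := by
  unfold hellingerSq
  ring

theorem integrable_sqrt_mul (hs : IsDensity μ s) (hg : IsDensity μ g) :
    Integrable (fun y => √(s y) * √(g y)) μ :=
  hs.memLp_sqrt.integrable_mul hg.memLp_sqrt

theorem integral_sqrt_mul (hs : IsDensity μ s) (hg : IsDensity μ g) :
    ∫ y, √(s y) * √(g y) ∂μ = 1 - hellingerSq μ s g := by
  have h : ∀ y, (√(s y) - √(g y)) ^ 2 = s y + g y - 2 * (√(s y) * √(g y)) := fun y => by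
    linear_combination Real.sq_sqrt (hs.nonneg y) + Real.sq_sqrt (hg.nonneg y)
  have h2 := integral_sq_sub (μ := μ) (s := s) (g := g)
  simp_rw [h] at h2
  rw [integral_sub (f := fun y => s y + g y) (hs.integrable.add hg.integrable)
      ((integrable_sqrt_mul hs hg).const_mul 2),
    integral_add hs.integrable hg.integrable, integral_const_mul, hs.integral_eq_one,
    hg.integral_eq_one] at h2
  linarith

theorem integrable_mul_score (hs : IsDensity μ s) (hg : IsDensity μ g) (hg' : IsDensity μ g') :
    Integrable (fun y => s y * score g g' y) μ := by
  simp_rw [mul_comm (s _)]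
  exact hs.integrable.bdd_mul (measurable_score hg hg').aestronglyMeasurable
    (Filter.Eventually.of_forall fun y => abs_score_le_one hg hg' y)

theorem integrable_mul_score_sq (hs : IsDensity μ s) (hg : IsDensity μ g)
    (hg' : IsDensity μ g') : Integrable (fun y => s y * score g g' y ^ 2) μ := by
  simp_rw [mul_comm (s _)]
  refine hs.integrable.bdd_mul (c := 1) ((measurable_score hg hg').pow_const 2).aestronglyMeasurable
    (Filter.Eventually.of_forall fun y => ?_)
  rw [Real.norm_eq_abs, abs_pow]
  exact pow_le_one₀ (abs_nonneg _) (abs_score_le_one hg hg' y)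

theorem integrable_sqrt_add_mul (hg : IsDensity μ g) (hg' : IsDensity μ g') :
    Integrable (fun y => √(g y + g' y) * (√(g' y) - √(g y))) μ := by
  have h : MemLp (fun y => √(g y + g' y)) 2 μ := by
    have hm : Measurable fun y => √(g y + g' y) := (hg.measurable.add hg'.measurable).sqrt
    rw [memLp_two_iff_integrable_sq hm.aestronglyMeasurable]
    simp_rw [fun y => Real.sq_sqrt (add_nonneg (hg.nonneg y) (hg'.nonneg y))]
    exact hg.integrable.add hg'.integrable
  exact h.integrable_mul (hg'.memLp_sqrt.sub hg.memLp_sqrt)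

/-- Under the density `s`, the mean of the test statistic of `g` against `g'` is at most
`(√2 + 1) h²(s, g) - (√2 - 1) h²(s, g')`. -/
theorem drift_le (hs : IsDensity μ s) (hg : IsDensity μ g) (hg' : IsDensity μ g') :
    ∫ y, s y * score g g' y ∂μ + 1 / 2 * ∫ y, √(g y + g' y) * (√(g' y) - √(g y)) ∂μ
      ≤ (√2 + 1) * hellingerSq μ s g - (√2 - 1) * hellingerSq μ s g' := by
  have i1 := integrable_mul_score hs hg hg'
  have i2 := (integrable_sqrt_add_mul hg hg').const_mul (1 / 2)
  have i3 := integrable_sq_sub hs hg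
  have i4 := integrable_sq_sub hs hg'
  have i5 := integrable_sqrt_mul hs hg
  have i6 := integrable_sqrt_mul hs hg'
  have h : ∀ y, s y * score g g' y + 1 / 2 * (√(g y + g' y) * (√(g' y) - √(g y)))
      ≤ 1 / 2 * ((√(s y) - √(g y)) ^ 2 + (√(s y) - √(g' y)) ^ 2)
        + √2 * (√(s y) * √(g' y) - √(s y) * √(g y)) := fun y => by
    have := drift_pointwise (Real.sqrt_nonneg (s y)) (Real.sqrt_nonneg (g y))
      (Real.sqrt_nonneg (g' y))
    rwa [Real.sq_sqrt (hs.nonneg y), Real.sq_sqrt (hg.nonneg y), Real.sq_sqrt (hg'.nonneg y),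
      mul_sub (√(s y))] at this
  have i34 : Integrable (fun y => 1 / 2 * ((√(s y) - √(g y)) ^ 2 + (√(s y) - √(g' y)) ^ 2)) μ :=
    (i3.add i4).const_mul (1 / 2)
  have i65 : Integrable (fun y => √2 * (√(s y) * √(g' y) - √(s y) * √(g y))) μ :=
    (i6.sub i5).const_mul √2
  have key := integral_mono (i1.add i2) (i34.add i65) h
  simp only [Pi.add_apply] at key
  rw [integral_add i1 i2, integral_const_mul, integral_add i34 i65, integral_const_mul,
    integral_const_mul, integral_add i3 i4, integral_sub i6 i5, integral_sq_sub, integral_sq_sub,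
    integral_sqrt_mul hs hg, integral_sqrt_mul hs hg'] at key
  linarith

theorem integral_mul_score_sq_le (hs : IsDensity μ s) (hg : IsDensity μ g)
    (hg' : IsDensity μ g') :
    ∫ y, s y * score g g' y ^ 2 ∂μ ≤ 6 * (hellingerSq μ s g + hellingerSq μ s g') := by
  have i3 := integrable_sq_sub hs hg
  have i4 := integrable_sq_sub hs hg'
  have h : ∀ y, s y * score g g' y ^ 2
      ≤ 3 * ((√(s y) - √(g y)) ^ 2 + (√(s y) - √(g' y)) ^ 2) := fun y => by
    have := score_sq_pointwise (Real.sqrt_nonneg (s y)) (Real.sqrt_nonneg (g y))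
      (Real.sqrt_nonneg (g' y))
    rwa [Real.sq_sqrt (hs.nonneg y), Real.sq_sqrt (hg.nonneg y), Real.sq_sqrt (hg'.nonneg y)]
      at this
  have i34 : Integrable (fun y => 3 * ((√(s y) - √(g y)) ^ 2 + (√(s y) - √(g' y)) ^ 2)) μ :=
    (i3.add i4).const_mul 3
  have key := integral_mono (integrable_mul_score_sq hs hg hg') i34 h
  rw [integral_const_mul, integral_add i3 i4, integral_sq_sub, integral_sq_sub] at key
  linarith

theorem testFunctional_swap {n : ℕ} (x : Fin n → 𝕏) :
    testFunctional μ x g' g = -testFunctional μ x g g' := by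
  have h1 : ∀ i, (√(g (x i)) - √(g' (x i))) / √(g' (x i) + g (x i))
      = -((√(g' (x i)) - √(g (x i))) / √(g (x i) + g' (x i))) := fun i => score_swap (x i)
  have h2 : ∀ y, √(g' y + g y) * (√(g y) - √(g' y))
      = -(√(g y + g' y) * (√(g' y) - √(g y))) := fun y => by
    rw [add_comm (g' y)]
    ring
  unfold testFunctional
  simp_rw [h1, h2, integral_neg, Finset.sum_neg_distrib]
  ring

end Moments

/-! ### Deviations of the test statistic -/

/-- A Bernstein-type bound for a variable with values in `[-1, 1]`, from
`exp x ≤ 1 + x + x²` for `|x| ≤ 1`. -/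
theorem mgf_le_exp {Ω : Type*} [MeasurableSpace Ω] {P : Measure Ω} [IsProbabilityMeasure P]
    {Y : Ω → ℝ} (hY : Measurable Y) (hY1 : ∀ ω, |Y ω| ≤ 1) {β : ℝ} (hβ0 : 0 ≤ β) (hβ1 : β ≤ 1) :
    mgf Y P β ≤ Real.exp (β * ∫ ω, Y ω ∂P + β ^ 2 * ∫ ω, Y ω ^ 2 ∂P) := by
  have hb : ∀ ω, |β * Y ω| ≤ 1 := fun ω => by
    rw [abs_mul, abs_of_nonneg hβ0]
    exact mul_le_one₀ hβ1 (abs_nonneg _) (hY1 ω)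
  have hi1 : Integrable Y P := Integrable.of_bound hY.aestronglyMeasurable 1
    (Filter.Eventually.of_forall hY1)
  have hi2 : Integrable (fun ω => Y ω ^ 2) P :=
    Integrable.of_bound (hY.pow_const 2).aestronglyMeasurable 1
      (Filter.Eventually.of_forall fun ω => by
        rw [Real.norm_eq_abs, abs_pow]
        exact pow_le_one₀ (abs_nonneg _) (hY1 ω))
  have hi3 : Integrable (fun ω => Real.exp (β * Y ω)) P :=
    Integrable.of_bound (hY.const_mul β).exp.aestronglyMeasurable (Real.exp 1)
      (Filter.Eventually.of_forall fun ω => by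
        rw [Real.norm_eq_abs, Real.abs_exp]
        exact Real.exp_le_exp.2 (le_of_abs_le (hb ω)))
  have hle : ∀ ω, Real.exp (β * Y ω) ≤ (1 + β * Y ω) + β ^ 2 * Y ω ^ 2 := fun ω => by
    have := le_of_abs_le (Real.abs_exp_sub_one_sub_id_le (hb ω))
    nlinarith
  have hi4 : Integrable (fun ω => 1 + β * Y ω) P := (integrable_const 1).add (hi1.const_mul β)
  have key := integral_mono hi3 (hi4.add (hi2.const_mul (β ^ 2))) hle
  simp only [Pi.add_apply] at key
  rw [integral_add hi4 (hi2.const_mul _), integral_add (integrable_const 1) (hi1.const_mul β),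
    integral_const_mul, integral_const_mul] at key
  simp only [integral_const, probReal_univ, one_smul] at key
  refine key.trans (le_trans (le_of_eq ?_) (Real.add_one_le_exp _))
  ring

section Deviation

variable {Ω 𝕏 : Type*} [MeasurableSpace Ω] [MeasurableSpace 𝕏] {P : Measure Ω}
  {μ : Measure 𝕏} {n : ℕ} {s g g' : 𝕏 → ℝ} {X : Fin n → Ω → 𝕏}

theorem integral_comp_of_map_eq (hs : IsDensity μ s) {Y : Ω → 𝕏} (hY : Measurable Y)
    (hmap : P.map Y = μ.withDensity (fun x => ENNReal.ofReal (s x))) {φ : 𝕏 → ℝ}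
    (hφ : Measurable φ) : ∫ ω, φ (Y ω) ∂P = ∫ y, s y * φ y ∂μ := by
  rw [← integral_map hY.aemeasurable hφ.aestronglyMeasurable, hmap,
    integral_withDensity_eq_integral_toReal_smul hs.measurable.ennreal_ofReal
      (Filter.Eventually.of_forall fun _ => ENNReal.ofReal_lt_top)]
  simp only [ENNReal.toReal_ofReal (hs.nonneg _), smul_eq_mul]

variable [IsProbabilityMeasure P]

theorem measureReal_testFunctional_ge_le (hn : 1 ≤ n) (hs : IsDensity μ s)
    (hg : IsDensity μ g) (hg' : IsDensity μ g') (hX : ∀ i, Measurable (X i))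
    (hind : iIndepFun X P)
    (hmap : ∀ i, P.map (X i) = μ.withDensity (fun x => ENNReal.ofReal (s x)))
    {β : ℝ} (hβ0 : 0 ≤ β) (hβ1 : β ≤ 1) (x : ℝ) :
    P.real {ω | x ≤ testFunctional μ (fun i => X i ω) g g'}
      ≤ Real.exp (n * β * ((√2 + 1) * hellingerSq μ s g - (√2 - 1) * hellingerSq μ s g'
        + 6 * β * (hellingerSq μ s g + hellingerSq μ s g') - x)) := by
  have hn0 : (0 : ℝ) < n := by exact_mod_cast hn
  have hsc := measurable_score hg hg'
  obtain ⟨I, hI⟩ : ∃ I, I = 1 / 2 * ∫ y, √(g y + g' y) * (√(g' y) - √(g y)) ∂μ := ⟨_, rfl⟩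
  have hm : ∀ i, Measurable fun ω => score g g' (X i ω) := fun i => hsc.comp (hX i)
  have hind' : iIndepFun (fun i ω => score g g' (X i ω)) P :=
    hind.comp (fun _ => score g g') fun _ => hsc
  have hmgf : mgf (∑ i, fun ω => score g g' (X i ω)) P β
      ≤ Real.exp (n * (β * ∫ y, s y * score g g' y ∂μ
          + β ^ 2 * ∫ y, s y * score g g' y ^ 2 ∂μ)) := by
    rw [hind'.mgf_sum hm]
    refine (Finset.prod_le_prod (fun i _ => mgf_nonneg) fun i _ =>
      mgf_le_exp (hm i) (fun ω => abs_score_le_one hg hg' _) hβ0 hβ1).trans (le_of_eq ?_)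
    simp_rw [integral_comp_of_map_eq hs (hX _) (hmap _) hsc,
      integral_comp_of_map_eq hs (hX _) (hmap _) (hsc.pow_const 2)]
    rw [Finset.prod_const, Finset.card_univ, Fintype.card_fin, ← Real.exp_nat_mul]
  have hset : {ω | x ≤ testFunctional μ (fun i => X i ω) g g'}
      = {ω | n * (x - I) ≤ (∑ i, fun ω => score g g' (X i ω)) ω} := by
    ext ω
    simp only [Set.mem_ofPred_eq, testFunctional, ← hI, Finset.sum_apply]
    change _ ≤ 1 / (n : ℝ) * ∑ i, score g g' (X i ω) + I ↔ _
    rw [← sub_le_iff_le_add, one_div, ← div_eq_inv_mul, le_div_iff₀' hn0]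
  have hsum : ∀ ω, |(∑ i, fun ω => score g g' (X i ω)) ω| ≤ n := fun ω => by
    rw [Finset.sum_apply]
    refine (Finset.abs_sum_le_sum_abs _ _).trans
      ((Finset.sum_le_sum fun i _ => abs_score_le_one hg hg' (X i ω)).trans ?_)
    simp
  have hint : Integrable (fun ω => Real.exp (β * (∑ i, fun ω => score g g' (X i ω)) ω)) P := by
    have hms : Measurable (∑ i, fun ω => score g g' (X i ω)) := by
      rw [Finset.sum_fn]
      exact Finset.univ.measurable_sum fun i _ => hm i
    refine Integrable.of_bound ((hms.const_mul β).exp.aestronglyMeasurable) (Real.exp (β * n))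
      (Filter.Eventually.of_forall fun ω => ?_)
    rw [Real.norm_eq_abs, Real.abs_exp]
    exact Real.exp_le_exp.2 (mul_le_mul_of_nonneg_left (le_of_abs_le (hsum ω)) hβ0)
  rw [hset]
  refine (measure_ge_le_exp_mul_mgf _ hβ0 hint).trans
    ((mul_le_mul_of_nonneg_left hmgf (Real.exp_pos _).le).trans ?_)
  rw [← Real.exp_add]
  refine Real.exp_le_exp.2 ?_
  have h1 := drift_le hs hg hg'
  have h2 := integral_mul_score_sq_le hs hg hg'
  rw [← hI] at h1
  have h3 := mul_le_mul_of_nonneg_left h1 (mul_nonneg hn0.le hβ0)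
  have h4 := mul_le_mul_of_nonneg_left h2 (mul_nonneg hn0.le (sq_nonneg β))
  nlinarith

/-- Uniform deviation bound over a finite family of densities. The exponential moment of the
second-moment term is absorbed by half of the slack `δ`; the other half makes the bounds for the
pairs of the family summable, independently of its size. -/
theorem measure_exists_test_ge_le (hn : 1 ≤ n) (hs : IsDensity μ s)
    (hX : ∀ i, Measurable (X i)) (hind : iIndepFun X P)
    (hmap : ∀ i, P.map (X i) = μ.withDensity (fun x => ENNReal.ofReal (s x)))
    {ι : Type*} (V : Finset ι) (G : ι → 𝕏 → ℝ) (hG : ∀ l ∈ V, IsDensity μ (G l))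
    {g₀ : 𝕏 → ℝ} (hg₀ : IsDensity μ g₀) {δ : ℝ} (hδ0 : 0 ≤ δ) (hδ1 : δ ≤ 1) {A : ℝ}
    (hA : ∑ l ∈ V, Real.exp (-(n * (δ / 12) * δ / 4 * hellingerSq μ (G l) g₀)) ≤ A) (x : ℝ) :
    P {ω | ∃ l ∈ V, ∃ l' ∈ V, (√2 + 1 + δ) * hellingerSq μ s (G l)
        - (√2 - 1 - δ) * hellingerSq μ s (G l') + x
          ≤ testFunctional μ (fun i => X i ω) (G l) (G l')}
      ≤ ENNReal.ofReal (A ^ 2 * Real.exp (n * (δ / 12) * (δ * hellingerSq μ s g₀ - x))) := by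
  obtain ⟨β, hβ⟩ : ∃ β, β = δ / 12 := ⟨_, rfl⟩
  rw [← hβ] at hA ⊢
  have hβ0 : 0 ≤ β := by rw [hβ]; positivity
  have hn0 : (0 : ℝ) ≤ n := Nat.cast_nonneg n
  have hc : 0 ≤ n * β * δ := by positivity
  have hpair : ∀ l ∈ V, ∀ l' ∈ V, P.real {ω | (√2 + 1 + δ) * hellingerSq μ s (G l)
        - (√2 - 1 - δ) * hellingerSq μ s (G l') + x
          ≤ testFunctional μ (fun i => X i ω) (G l) (G l')}
      ≤ Real.exp (n * β * (δ * hellingerSq μ s g₀ - x))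
        * (Real.exp (-(n * β * δ / 4 * hellingerSq μ (G l) g₀))
          * Real.exp (-(n * β * δ / 4 * hellingerSq μ (G l') g₀))) := by
    intro l hl l' hl'
    refine (measureReal_testFunctional_ge_le hn hs (hG l hl) (hG l' hl') hX hind hmap hβ0
      (by linarith) _).trans ?_
    rw [← Real.exp_add, ← Real.exp_add]
    refine Real.exp_le_exp.2 ?_
    have h1 := mul_le_mul_of_nonneg_left (half_hellingerSq_sub_le (hG l hl) hs hg₀) hc
    have h2 := mul_le_mul_of_nonneg_left (half_hellingerSq_sub_le (hG l' hl') hs hg₀) hc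
    have h3 : δ = 12 * β := by rw [hβ]; ring
    rw [h3] at h1 h2 ⊢
    nlinarith
  have hsum : 0 ≤ ∑ l ∈ V, Real.exp (-(n * β * δ / 4 * hellingerSq μ (G l) g₀)) :=
    Finset.sum_nonneg fun l _ => (Real.exp_pos _).le
  have hset : {ω | ∃ l ∈ V, ∃ l' ∈ V, (√2 + 1 + δ) * hellingerSq μ s (G l)
        - (√2 - 1 - δ) * hellingerSq μ s (G l') + x
          ≤ testFunctional μ (fun i => X i ω) (G l) (G l')}
      = ⋃ l ∈ V, ⋃ l' ∈ V, {ω | (√2 + 1 + δ) * hellingerSq μ s (G l)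
        - (√2 - 1 - δ) * hellingerSq μ s (G l') + x
          ≤ testFunctional μ (fun i => X i ω) (G l) (G l')} := by
    ext ω
    simp
  rw [hset, ← ofReal_measureReal (measure_ne_top P _)]
  refine ENNReal.ofReal_le_ofReal ((measureReal_biUnion_finset_le _ _).trans
    ((Finset.sum_le_sum fun l hl => (measureReal_biUnion_finset_le _ _).trans
      (Finset.sum_le_sum fun l' hl' => hpair l hl l' hl')).trans ?_))
  simp_rw [← Finset.mul_sum]
  rw [← Finset.sum_mul, mul_comm, ← sq]
  exact mul_le_mul_of_nonneg_right (pow_le_pow_left₀ hsum hA 2) (Real.exp_pos _).le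

end Deviation

/-! ### The size of the grid -/

/-- The sum `∑_{l ∈ ℤ^d} exp (-∑ j, c_j |l_j|^{α_j})`, as a product over the coordinates. -/
noncomputable def latticeSum {d : ℕ} (c α : Fin d → ℝ) : ℝ :=
  ∏ j, ∑' l : ℤ, Real.exp (-(c j * |(l : ℝ)| ^ α j))

theorem summable_exp_neg_rpow {c α : ℝ} (hc : 0 < c) (hα : 0 < α) :
    Summable fun l : ℤ => Real.exp (-(c * |(l : ℝ)| ^ α)) := by
  have h : Summable fun m : ℕ => Real.exp (-(c * (m : ℝ) ^ α)) := by
    have h1 := ((isLittleO_exp_neg_mul_rpow_atTop hc (-2 / α)).comp_tendsto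
      (tendsto_rpow_atTop hα)).comp_tendsto tendsto_natCast_atTop_atTop
    refine summable_of_isBigO_nat (Real.summable_nat_rpow.2 (by norm_num : (-2 : ℝ) < -1)) ?_
    refine h1.isBigO.congr (fun m => by simp) fun m => ?_
    simp only [Function.comp]
    rw [← Real.rpow_mul (Nat.cast_nonneg m)]
    congr 1
    field_simp
  refine Summable.of_nat_of_neg (h.congr fun m => ?_) (h.congr fun m => ?_) <;> simp

theorem latticeSum_pos {d : ℕ} {c α : Fin d → ℝ} (hc : ∀ j, 0 < c j) (hα : ∀ j, 0 < α j) :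
    0 < latticeSum c α :=
  Finset.prod_pos fun j _ =>
    (summable_exp_neg_rpow (hc j) (hα j)).tsum_pos (fun _ => (Real.exp_pos _).le) 0
      (Real.exp_pos _)

/-- Weights that decay along each coordinate are summable over the grid, uniformly in its extent:
the hypothesis makes `H l` at least the sum over `j` of `c_j |l_j - l₀_j|^{α_j}`, so that the sum
factorises. -/
theorem sum_exp_neg_le_latticeSum {d : ℕ} (hd : 1 ≤ d) {c α : Fin d → ℝ} (hc : ∀ j, 0 < c j)
    (hα : ∀ j, 0 < α j) (V : Fin d → Finset ℤ) (l₀ : Fin d → ℤ) (H : (Fin d → ℤ) → ℝ)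
    (hH : ∀ l ∈ Fintype.piFinset V, ∀ j, d * (c j * |((l j - l₀ j : ℤ) : ℝ)| ^ α j) ≤ H l) :
    ∑ l ∈ Fintype.piFinset V, Real.exp (-H l) ≤ latticeSum c α := by
  calc ∑ l ∈ Fintype.piFinset V, Real.exp (-H l)
      ≤ ∑ l ∈ Fintype.piFinset V,
          ∏ j, Real.exp (-(c j * |((l j - l₀ j : ℤ) : ℝ)| ^ α j)) := by
        refine Finset.sum_le_sum fun l hl => ?_
        rw [← Real.exp_sum, Finset.sum_neg_distrib]
        refine Real.exp_le_exp.2 (neg_le_neg ?_)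
        have hd' : (0 : ℝ) < d := by exact_mod_cast hd
        have := Finset.sum_le_card_nsmul Finset.univ
          (fun j => c j * |((l j - l₀ j : ℤ) : ℝ)| ^ α j) (H l / d)
          fun j _ => by rw [le_div_iff₀' hd']; exact hH l hl j
        simp only [Finset.card_univ, Fintype.card_fin, nsmul_eq_mul] at this
        rwa [mul_div_cancel₀ _ hd'.ne'] at this
    _ = ∏ j, ∑ l ∈ V j, Real.exp (-(c j * |((l - l₀ j : ℤ) : ℝ)| ^ α j)) :=
        (Finset.prod_univ_sum V
          fun j l => Real.exp (-(c j * |((l - l₀ j : ℤ) : ℝ)| ^ α j))).symm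
    _ ≤ latticeSum c α := by
        refine Finset.prod_le_prod (fun j _ => Finset.sum_nonneg fun l _ => (Real.exp_pos _).le)
          fun j _ => ?_
        have hsum := summable_exp_neg_rpow (hc j) (hα j)
        refine (((Equiv.subRight (l₀ j)).summable_iff.2 hsum).sum_le_tsum (V j)
          fun l _ => (Real.exp_pos _).le).trans (le_of_eq ?_)
        exact (Equiv.subRight (l₀ j)).tsum_eq
          fun l : ℤ => Real.exp (-(c j * |(l : ℝ)| ^ α j))

/-! ### The enumeration of boxes within one step -/

section Odometer

variable {d : ℕ} {p : Tuning d} {C : Rect d} {k : Fin d}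

theorem exists_enum_eq (hinj : Function.Injective (p.ψ k)) (hne : ∀ i, p.ψ k i ≠ k) {j : Fin d}
    (hj : j ≠ k) : ∃ i, p.ψ k i = j := by
  classical
  have hsub : Finset.univ.image (p.ψ k) ⊆ Finset.univ.erase k := by
    intro x hx
    obtain ⟨i, -, rfl⟩ := Finset.mem_image.1 hx
    exact Finset.mem_erase.2 ⟨hne i, Finset.mem_univ _⟩
  have heq := Finset.eq_of_subset_of_card_le hsub (by
    rw [Finset.card_image_of_injective _ hinj, Finset.card_erase_of_mem (Finset.mem_univ k)]
    simp)
  have : j ∈ Finset.univ.image (p.ψ k) := by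
    rw [heq]
    exact Finset.mem_erase.2 ⟨hj, Finset.mem_univ _⟩
  obtain ⟨i, -, hi⟩ := Finset.mem_image.1 this
  exact ⟨i, hi⟩

/-- Every point of the slab `{q ∈ C | w q ≤ ε k}` that precedes `θ` is covered. Here `q` precedes
`θ` if for some level `i` the coordinate `ψ_k(i)` of `q` is smaller than that of `θ`, while at the
higher levels `q` lies in the current layer `[θ, θ + ε]`. The function `w` is the distance to
the face of `C` that is to be cut off. -/
def CoveredBefore (p : Tuning d) (C : Rect d) (k : Fin d) (w : (Fin d → ℝ) → ℝ)
    (cov : (Fin d → ℝ) → Prop) (θ ε : Fin d → ℝ) : Prop :=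
  ∀ q ∈ C.toSet, w q ≤ ε k → ∀ i : Fin (d - 1),
    (∀ l, i < l → θ (p.ψ k l) ≤ q (p.ψ k l) ∧ q (p.ψ k l) ≤ θ (p.ψ k l) + ε (p.ψ k l)) →
    q (p.ψ k i) < θ (p.ψ k i) → cov q

variable {w : (Fin d → ℝ) → ℝ} {cov : (Fin d → ℝ) → Prop} {θ ε r : Fin d → ℝ}

theorem updateEps_le_right (j : Fin d) : updateEps p k r ε j ≤ r j := by
  unfold updateEps
  split_ifs
  · exact le_rfl
  · exact min_le_right _ _

/-- Only the side length at the lowest level of the enumeration may grow. -/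
theorem updateEps_le_left (hinj : Function.Injective (p.ψ k)) {i l : Fin (d - 1)} (hl : i < l) :
    updateEps p k r ε (p.ψ k l) ≤ ε (p.ψ k l) := by
  unfold updateEps
  split_ifs with h
  · obtain ⟨m, hm, h⟩ := h
    rw [hinj h] at hm
    have := Fin.lt_def.1 hl
    omega
  · exact min_le_left _ _

theorem updateEps_self_le (hne : ∀ i, p.ψ k i ≠ k) : updateEps p k r ε k ≤ ε k := by
  unfold updateEps
  rw [if_neg (by rintro ⟨i, -, h⟩; exact hne i h)]
  exact min_le_left _ _

theorem updateEps_pos {j : Fin d} (hr : 0 < r j) (hε : 0 < ε j) : 0 < updateEps p k r ε j := by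
  unfold updateEps
  split_ifs
  · exact hr
  · exact lt_min hε hr

theorem coveredBefore_updateEps (hinj : Function.Injective (p.ψ k)) (hne : ∀ i, p.ψ k i ≠ k)
    (h : CoveredBefore p C k w cov θ ε) :
    CoveredBefore p C k w cov θ (updateEps p k r ε) := fun q hq hw i hl hi =>
  h q hq (hw.trans (updateEps_self_le hne)) i
    (fun l hil => ⟨(hl l hil).1, (hl l hil).2.trans (by
      linarith [updateEps_le_left (r := r) (ε := ε) hinj hil])⟩) hi

theorem advance_eq (hJ : (movable p C k θ ε).Nonempty) (j : Fin d) :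
    advance p C k θ ε j =
      open Classical in
      if ∃ i, i < (movable p C k θ ε).min' hJ ∧ p.ψ k i = j then C.lo j
      else if j = p.ψ k ((movable p C k θ ε).min' hJ) then θ j + ε j
      else θ j := by
  unfold advance
  rw [dif_pos hJ]

theorem advance_of_ne (hne : ∀ i, p.ψ k i ≠ k) : advance p C k θ ε k = θ k := by
  by_cases hJ : (movable p C k θ ε).Nonempty
  · rw [advance_eq hJ, if_neg (by rintro ⟨i, -, h⟩; exact hne i h), if_neg (hne _).symm]
  · unfold advance
    rw [dif_neg hJ]

theorem advance_mem (hC : C.lo ≤ C.hi) (hε : ∀ i, 0 ≤ ε (p.ψ k i)) (hθ : θ ∈ C.toSet) :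
    advance p C k θ ε ∈ C.toSet := by
  by_cases hJ : (movable p C k θ ε).Nonempty
  · have hmem := Finset.min'_mem _ hJ
    simp only [movable, Finset.mem_filter, Finset.mem_univ, true_and] at hmem
    refine ⟨fun j => ?_, fun j => ?_⟩ <;> rw [advance_eq hJ] <;> split_ifs with h1 h2
    · exact le_rfl
    · rw [h2]
      exact (hθ.1 _).trans (le_add_of_nonneg_right (hε _))
    · exact hθ.1 j
    · exact hC j
    · rw [h2]
      exact hmem.le
    · exact hθ.2 j
  · unfold advance
    rwa [dif_neg hJ]

/-- A point of the slab that lies, at the levels up to `i₀`, below the upper end of the current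
box and, at the levels above `i₀`, in the current layer is covered: it lies in the current box or
precedes `θ`. -/
theorem CoveredBefore.cov_of_le (h : CoveredBefore p C k w cov θ ε)
    (hbox : ∀ q ∈ C.toSet, w q ≤ ε k → (∀ i, θ (p.ψ k i) ≤ q (p.ψ k i) ∧
      q (p.ψ k i) ≤ θ (p.ψ k i) + ε (p.ψ k i)) → cov q)
    {q : Fin d → ℝ} (hq : q ∈ C.toSet) (hw : w q ≤ ε k)
    (hup : ∀ l, q (p.ψ k l) ≤ θ (p.ψ k l) + ε (p.ψ k l)) : cov q := by
  classical
  by_cases hall : ∀ i, θ (p.ψ k i) ≤ q (p.ψ k i)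
  · exact hbox q hq hw fun i => ⟨hall i, hup i⟩
  · have hne : (Finset.univ.filter fun i => q (p.ψ k i) < θ (p.ψ k i)).Nonempty := by
      push Not at hall
      obtain ⟨i, hi⟩ := hall
      exact ⟨i, by simpa using hi⟩
    have hmem := Finset.max'_mem _ hne
    simp only [Finset.mem_filter, Finset.mem_univ, true_and] at hmem
    refine h q hq hw _ (fun l hl => ⟨?_, hup l⟩) hmem
    by_contra hlt
    exact absurd (Finset.le_max' (Finset.univ.filter fun i => q (p.ψ k i) < θ (p.ψ k i)) l
      (by simpa using hlt)) (not_le.2 hl)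

theorem CoveredBefore.cov_of_exhausted (h : CoveredBefore p C k w cov θ ε)
    (hbox : ∀ q ∈ C.toSet, w q ≤ ε k → (∀ i, θ (p.ψ k i) ≤ q (p.ψ k i) ∧
      q (p.ψ k i) ≤ θ (p.ψ k i) + ε (p.ψ k i)) → cov q)
    (hJ : ¬ (movable p C k θ ε).Nonempty) {q : Fin d → ℝ} (hq : q ∈ C.toSet) (hw : w q ≤ ε k) :
    cov q := by
  refine h.cov_of_le hbox hq hw fun l => ?_
  by_contra hlt
  exact hJ ⟨l, by
    simp only [movable, Finset.mem_filter, Finset.mem_univ, true_and]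
    exact (not_le.1 hlt).trans_le (hq.2 _)⟩

theorem coveredBefore_advance (hinj : Function.Injective (p.ψ k))
    (h : CoveredBefore p C k w cov θ ε)
    (hbox : ∀ q ∈ C.toSet, w q ≤ ε k → (∀ i, θ (p.ψ k i) ≤ q (p.ψ k i) ∧
      q (p.ψ k i) ≤ θ (p.ψ k i) + ε (p.ψ k i)) → cov q) :
    CoveredBefore p C k w cov (advance p C k θ ε) ε := by
  by_cases hJ : (movable p C k θ ε).Nonempty
  swap
  · unfold advance
    rwa [dif_neg hJ]
  obtain ⟨i₀, hi₀⟩ : ∃ i₀, i₀ = (movable p C k θ ε).min' hJ := ⟨_, rfl⟩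
  have hlow : ∀ l, l < i₀ → advance p C k θ ε (p.ψ k l) = C.lo (p.ψ k l) := fun l hl => by
    rw [advance_eq hJ, if_pos ⟨l, hi₀ ▸ hl, rfl⟩]
  have hat : advance p C k θ ε (p.ψ k i₀) = θ (p.ψ k i₀) + ε (p.ψ k i₀) := by
    rw [advance_eq hJ, if_neg, if_pos (by rw [hi₀])]
    rintro ⟨i, hi, hii⟩
    rw [← hi₀] at hi
    exact hi.ne (hinj hii)
  have hhigh : ∀ l, i₀ < l → advance p C k θ ε (p.ψ k l) = θ (p.ψ k l) := fun l hl => by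
    rw [advance_eq hJ, if_neg, if_neg]
    · rw [← hi₀]
      exact fun h => hl.ne' (hinj h)
    · rintro ⟨i, hi, hii⟩
      rw [← hi₀] at hi
      exact (hi.trans hl).ne (hinj hii)
  have hstuck : ∀ l, l < i₀ → C.hi (p.ψ k l) ≤ θ (p.ψ k l) + ε (p.ψ k l) := fun l hl => by
    by_contra hlt
    refine absurd (Finset.min'_le (movable p C k θ ε) l ?_) (not_le.2 (hi₀ ▸ hl))
    simp only [movable, Finset.mem_filter, Finset.mem_univ, true_and]
    exact not_le.1 hlt
  intro q hq hw i hl hi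
  rcases lt_trichotomy i i₀ with hii | rfl | hii
  · rw [hlow i hii] at hi
    exact absurd (hq.1 _) (not_le.2 hi)
  · rw [hat] at hi
    refine h.cov_of_le hbox hq hw fun l => ?_
    rcases lt_trichotomy l i with hli | rfl | hli
    · exact (hq.2 _).trans (hstuck l hli)
    · exact hi.le
    · have := (hl l hli).2
      rwa [hhigh l hli] at this
  · rw [hhigh i hii] at hi
    refine h q hq hw i (fun l hil => ?_) hi
    have := hl l hil
    rwa [hhigh l (hii.trans hil)] at this

end Odometer

/-! ### One step of the procedure -/

section Step

variable {𝕏 : Type*} [MeasurableSpace 𝕏] {d : ℕ} {μ : Measure 𝕏} {f : (Fin d → ℝ) → 𝕏 → ℝ}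
  {Θ C C' : Rect d} {p : Tuning d} {α Rlo : Fin d → ℝ} {κ : ℝ} {k : Fin d}
  {T : (Fin d → ℝ) → (Fin d → ℝ) → ℝ} {S : LoopState d}

/-- The parameter `q` may be discarded when `C` is shortened along `k`: some comparison between
points `θ, θ'` of the two opposite faces of `C` was not won by the point whose Hellinger ball
of radius `√κ h(f_θ, f_θ')` contains `q`. -/
def Discardable (μ : Measure 𝕏) (f : (Fin d → ℝ) → 𝕏 → ℝ) (Θ : Rect d) (κ : ℝ)
    (T : (Fin d → ℝ) → (Fin d → ℝ) → ℝ) (C : Rect d) (k : Fin d) (q : Fin d → ℝ) : Prop :=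
  ∃ θ ∈ C.toSet, ∃ θ' ∈ C.toSet, θ k = C.lo k ∧ θ' k = C.hi k ∧
    ((0 ≤ T θ θ' ∧ q ∈ hellingerBall μ f Θ θ (√κ * hellinger μ (f θ) (f θ'))) ∨
      (T θ θ' ≤ 0 ∧ q ∈ hellingerBall μ f Θ θ' (√κ * hellinger μ (f θ') (f θ))))

/-- The invariant of the inner loop: `θ, θ'` lie on the two faces of `C` orthogonal to `k`, and
each of the two enumerations has covered all that precedes its current point. -/
structure LoopInvariant (p : Tuning d) (C : Rect d) (k : Fin d) (cov : (Fin d → ℝ) → Prop)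
    (S : LoopState d) : Prop where
  mem : S.θ ∈ C.toSet
  mem' : S.θ' ∈ C.toSet
  eq_lo : S.θ k = C.lo k
  eq_hi : S.θ' k = C.hi k
  pos : ∀ j, 0 < S.ε j
  pos' : ∀ j, 0 < S.ε' j
  le_half : S.ε k ≤ (C.hi k - C.lo k) / 2
  le_half' : S.ε' k ≤ (C.hi k - C.lo k) / 2
  covered : CoveredBefore p C k (fun q => q k - C.lo k) cov S.θ S.ε
  covered' : CoveredBefore p C k (fun q => C.hi k - q k) cov S.θ' S.ε'

theorem LoopInvariant.ne {cov : (Fin d → ℝ) → Prop} (h : LoopInvariant p C k cov S)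
    (hlt : C.lo k < C.hi k) : S.θ ≠ S.θ' := fun heq =>
  hlt.ne (by rw [← h.eq_lo, heq, h.eq_hi])

theorem loopInvariant_initState (hp : p.Admissible μ f Θ α Rlo κ) (hC : C.IsSubrect Θ)
    (hlt : C.lo k < C.hi k) (cov : (Fin d → ℝ) → Prop) :
    LoopInvariant p C k cov (initState p C k) := by
  have hmem : C.lo ∈ C.toSet := ⟨le_rfl, hC.1⟩
  have hmem' : Function.update C.lo k (C.hi k) ∈ C.toSet := by
    constructor <;> intro j <;> by_cases hj : j = k
    · subst hj; simpa using hlt.le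
    · simp [hj]
    · subst hj; simp
    · simpa [hj] using hC.1 j
  have hne : C.lo ≠ Function.update C.lo k (C.hi k) := fun h => by
    have := congrFun h k
    simp only [Function.update_self] at this
    exact hlt.ne this
  have hhalf : 0 < (C.hi k - C.lo k) / 2 := by linarith
  refine ⟨hmem, hmem', rfl, by simp [initState], fun j => ?_, fun j => ?_, by simp [initState],
    by simp [initState], fun q hq _ i _ hi => absurd (hq.1 _) (not_le.2 hi),
    fun q hq _ i _ hi => ?_⟩
  · simp only [initState]
    split_ifs
    exacts [hhalf, hp.rUp_pos C hC _ hmem _ hmem' hne j]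
  · simp only [initState]
    split_ifs
    exacts [hhalf, hp.rUp_pos C hC _ hmem' _ hmem hne.symm j]
  · simp only [initState, Function.update_of_ne (hp.ψ_ne k i)] at hi
    exact absurd (hq.1 _) (not_le.2 hi)

theorem nextEps_le (hne : ∀ i, p.ψ k i ≠ k) : nextEps T p C k S k ≤ S.ε k := by
  unfold nextEps
  split_ifs
  exacts [updateEps_self_le hne, le_rfl]

theorem nextEps'_le (hne : ∀ i, p.ψ k i ≠ k) : nextEps' T p C k S k ≤ S.ε' k := by
  unfold nextEps'
  split_ifs
  exacts [updateEps_self_le hne, le_rfl]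

/-- When the test does not favour `θ`, the box at `θ` with the updated side lengths may be
discarded. -/
theorem LoopInvariant.discardable_box (hp : p.Admissible μ f Θ α Rlo κ) (hC : C.IsSubrect Θ)
    (hlt : C.lo k < C.hi k) (hS : LoopInvariant p C k (Discardable μ f Θ κ T C k) S)
    (hT : 0 ≤ T S.θ S.θ') {q : Fin d → ℝ} (hq : q ∈ C.toSet)
    (hk : q k - C.lo k ≤ nextEps T p C k S k)
    (hbox : ∀ i, S.θ (p.ψ k i) ≤ q (p.ψ k i) ∧
      q (p.ψ k i) ≤ S.θ (p.ψ k i) + nextEps T p C k S (p.ψ k i)) :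
    Discardable μ f Θ κ T C k q := by
  have hne := hS.ne hlt
  refine ⟨S.θ, hS.mem, S.θ', hS.mem', hS.eq_lo, hS.eq_hi, Or.inl ⟨hT, ?_⟩⟩
  have hr : ∀ j, nextEps T p C k S j ≤ p.rUp C j S.θ S.θ' := fun j => by
    unfold nextEps
    rw [if_pos hT]
    exact updateEps_le_right j
  have hall : ∀ j, S.θ j ≤ q j ∧ q j ≤ S.θ j + nextEps T p C k S j := fun j => by
    by_cases hj : j = k
    · subst hj
      rw [hS.eq_lo]
      exact ⟨hq.1 _, by linarith⟩
    · obtain ⟨i, rfl⟩ := exists_enum_eq (hp.ψ_injective k) (hp.ψ_ne k) hj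
      exact hbox i
  refine hp.inter_subset_ball C hC _ hS.mem _ hS.mem' hne ⟨hq, fun j => ?_, fun j => ?_⟩
  · have := hp.rDown_pos C hC _ hS.mem _ hS.mem' hne j
    linarith [(hall j).1]
  · linarith [(hall j).2, hr j]

theorem LoopInvariant.discardable_box' (hp : p.Admissible μ f Θ α Rlo κ) (hC : C.IsSubrect Θ)
    (hlt : C.lo k < C.hi k) (hS : LoopInvariant p C k (Discardable μ f Θ κ T C k) S)
    (hT : T S.θ S.θ' ≤ 0) {q : Fin d → ℝ} (hq : q ∈ C.toSet)
    (hk : C.hi k - q k ≤ nextEps' T p C k S k)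
    (hbox : ∀ i, S.θ' (p.ψ k i) ≤ q (p.ψ k i) ∧
      q (p.ψ k i) ≤ S.θ' (p.ψ k i) + nextEps' T p C k S (p.ψ k i)) :
    Discardable μ f Θ κ T C k q := by
  have hne := (hS.ne hlt).symm
  refine ⟨S.θ, hS.mem, S.θ', hS.mem', hS.eq_lo, hS.eq_hi, Or.inr ⟨hT, ?_⟩⟩
  have hr : ∀ j, nextEps' T p C k S j
      ≤ if j = k then p.rDown C j S.θ' S.θ else p.rUp C j S.θ' S.θ := fun j => by
    unfold nextEps'
    rw [if_pos hT]
    convert updateEps_le_right (p := p) (k := k) (ε := S.ε')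
      (r := fun j => if j = k then p.rDown C j S.θ' S.θ else p.rUp C j S.θ' S.θ) j using 2
  have hup := hp.rUp_pos C hC _ hS.mem' _ hS.mem hne
  have hdown := hp.rDown_pos C hC _ hS.mem' _ hS.mem hne
  refine hp.inter_subset_ball C hC _ hS.mem' _ hS.mem hne ?_
  suffices h : ∀ j, S.θ' j - p.rDown C j S.θ' S.θ ≤ q j ∧ q j ≤ S.θ' j + p.rUp C j S.θ' S.θ from
    ⟨hq, fun j => (h j).1, fun j => (h j).2⟩
  intro j
  have h1 := hr j
  by_cases hj : j = k
  · subst hj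
    rw [if_pos rfl] at h1
    have h2 := hS.eq_hi
    have h3 := hq.2 j
    have h4 := hup j
    constructor <;> linarith
  · rw [if_neg hj] at h1
    obtain ⟨i, rfl⟩ := exists_enum_eq (hp.ψ_injective k) (hp.ψ_ne k) hj
    have h2 := hbox i
    have h3 := hdown (p.ψ k i)
    constructor <;> linarith

theorem LoopInvariant.nextEps_pos (hp : p.Admissible μ f Θ α Rlo κ) (hC : C.IsSubrect Θ)
    (hlt : C.lo k < C.hi k) {cov : (Fin d → ℝ) → Prop} (hS : LoopInvariant p C k cov S)
    (j : Fin d) : 0 < nextEps T p C k S j := by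
  unfold nextEps
  split_ifs
  exacts [updateEps_pos (hp.rUp_pos C hC _ hS.mem _ hS.mem' (hS.ne hlt) j) (hS.pos j), hS.pos j]

theorem LoopInvariant.nextEps'_pos (hp : p.Admissible μ f Θ α Rlo κ) (hC : C.IsSubrect Θ)
    (hlt : C.lo k < C.hi k) {cov : (Fin d → ℝ) → Prop} (hS : LoopInvariant p C k cov S)
    (j : Fin d) : 0 < nextEps' T p C k S j := by
  have hne := (hS.ne hlt).symm
  unfold nextEps'
  split_ifs
  · refine updateEps_pos ?_ (hS.pos' j)
    split_ifs
    exacts [hp.rDown_pos C hC _ hS.mem' _ hS.mem hne j, hp.rUp_pos C hC _ hS.mem' _ hS.mem hne j]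
  · exact hS.pos' j

theorem LoopInvariant.covered_nextEps (hp : p.Admissible μ f Θ α Rlo κ)
    {cov : (Fin d → ℝ) → Prop} (hS : LoopInvariant p C k cov S) :
    CoveredBefore p C k (fun q => q k - C.lo k) cov S.θ (nextEps T p C k S) := by
  unfold nextEps
  split_ifs
  exacts [coveredBefore_updateEps (hp.ψ_injective k) (hp.ψ_ne k) hS.covered, hS.covered]

theorem LoopInvariant.covered_nextEps' (hp : p.Admissible μ f Θ α Rlo κ)
    {cov : (Fin d → ℝ) → Prop} (hS : LoopInvariant p C k cov S) :
    CoveredBefore p C k (fun q => C.hi k - q k) cov S.θ' (nextEps' T p C k S) := by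
  unfold nextEps'
  split_ifs
  exacts [coveredBefore_updateEps (hp.ψ_injective k) (hp.ψ_ne k) hS.covered', hS.covered']

theorem LoopInvariant.nextState (hp : p.Admissible μ f Θ α Rlo κ) (hC : C.IsSubrect Θ)
    (hlt : C.lo k < C.hi k) (hS : LoopInvariant p C k (Discardable μ f Θ κ T C k) S) :
    LoopInvariant p C k (Discardable μ f Θ κ T C k) (nextState T p C k S) where
  mem := by
    simp only [RobustTests.nextState]
    split_ifs
    exacts [advance_mem hC.1 (fun i => (hS.nextEps_pos hp hC hlt _).le) hS.mem, hS.mem]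
  mem' := by
    simp only [RobustTests.nextState]
    split_ifs
    exacts [advance_mem hC.1 (fun i => (hS.nextEps'_pos hp hC hlt _).le) hS.mem', hS.mem']
  eq_lo := by
    simp only [RobustTests.nextState]
    split_ifs
    exacts [(advance_of_ne (hp.ψ_ne k)).trans hS.eq_lo, hS.eq_lo]
  eq_hi := by
    simp only [RobustTests.nextState]
    split_ifs
    exacts [(advance_of_ne (hp.ψ_ne k)).trans hS.eq_hi, hS.eq_hi]
  pos := hS.nextEps_pos hp hC hlt
  pos' := hS.nextEps'_pos hp hC hlt
  le_half := (nextEps_le (hp.ψ_ne k)).trans hS.le_half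
  le_half' := (nextEps'_le (hp.ψ_ne k)).trans hS.le_half'
  covered := by
    simp only [RobustTests.nextState]
    split_ifs with hT
    · exact coveredBefore_advance (hp.ψ_injective k) (hS.covered_nextEps hp)
        fun q hq => hS.discardable_box hp hC hlt hT hq
    · exact hS.covered_nextEps hp
  covered' := by
    simp only [RobustTests.nextState]
    split_ifs with hT
    · exact coveredBefore_advance (hp.ψ_injective k) (hS.covered_nextEps' hp)
        fun q hq => hS.discardable_box' hp hC hlt hT hq
    · exact hS.covered_nextEps' hp

theorem LoopInvariant.cutRect (hp : p.Admissible μ f Θ α Rlo κ) (hC : C.IsSubrect Θ)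
    (hlt : C.lo k < C.hi k) (hS : LoopInvariant p C k (Discardable μ f Θ κ T C k) S) :
    (cutRect T p C k S).IsSubrect C ∧
      ∀ q ∈ C.toSet, q ∉ (cutRect T p C k S).toSet → Discardable μ f Θ κ T C k q := by
  have h1 := hS.nextEps_pos (T := T) hp hC hlt k
  have h2 := hS.nextEps'_pos (T := T) hp hC hlt k
  have h3 := (nextEps_le (T := T) (C := C) (S := S) (hp.ψ_ne k)).trans hS.le_half
  have h4 := (nextEps'_le (T := T) (C := C) (S := S) (hp.ψ_ne k)).trans hS.le_half'
  have hlo : C.lo ≤ (RobustTests.cutRect T p C k S).lo := fun j => by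
    simp only [RobustTests.cutRect]
    split_ifs
    · by_cases hj : j = k
      · subst hj
        simpa using h1.le
      · simp [hj]
    · exact le_rfl
  have hhi : (RobustTests.cutRect T p C k S).hi ≤ C.hi := fun j => by
    simp only [RobustTests.cutRect]
    split_ifs
    · by_cases hj : j = k
      · subst hj
        simpa using h2.le
      · simp [hj]
    · exact le_rfl
  refine ⟨⟨fun j => ?_, fun q hq => ⟨hlo.trans hq.1, hq.2.trans hhi⟩⟩, fun q hq hq' => ?_⟩
  · have := hC.1 j
    simp only [RobustTests.cutRect]
    by_cases hj : j = k
    · subst hj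
      split_ifs <;> simp <;> linarith
    · split_ifs <;> simpa [hj] using this
  · by_cases hex : Exhausted T p C k S ∧ q k < C.lo k + nextEps T p C k S k
    · exact (hS.covered_nextEps hp).cov_of_exhausted
        (fun q hq => hS.discardable_box hp hC hlt hex.1.1 hq) hex.1.2 hq (by linarith [hex.2])
    by_cases hex' : Exhausted' T p C k S ∧ C.hi k - nextEps' T p C k S k < q k
    · exact (hS.covered_nextEps' hp).cov_of_exhausted
        (fun q hq => hS.discardable_box' hp hC hlt hex'.1.1 hq) hex'.1.2 hq (by linarith [hex'.2])
    refine absurd ⟨fun j => ?_, fun j => ?_⟩ hq'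
    · simp only [RobustTests.cutRect]
      split_ifs with h
      · by_cases hj : j = k
        · subst hj
          simpa using not_lt.1 fun hh => hex ⟨h, hh⟩
        · simpa [hj] using hq.1 j
      · exact hq.1 j
    · simp only [RobustTests.cutRect]
      split_ifs with h
      · by_cases hj : j = k
        · subst hj
          simpa using not_lt.1 fun hh => hex' ⟨h, hh⟩
        · simpa [hj] using hq.2 j
      · exact hq.2 j

theorem LoopReturns.isSubrect_and_discardable (hp : p.Admissible μ f Θ α Rlo κ)
    (hC : C.IsSubrect Θ) (hlt : C.lo k < C.hi k) (h : LoopReturns T p C k S C')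
    (hS : LoopInvariant p C k (Discardable μ f Θ κ T C k) S) :
    C'.IsSubrect C ∧ ∀ q ∈ C.toSet, q ∉ C'.toSet → Discardable μ f Θ κ T C k q := by
  induction h with
  | exit S _ => exact hS.cutRect hp hC hlt
  | again S C' _ _ ih => exact ih (hS.nextState hp hC hlt)

end Step

/-! ### The whole run -/

section Run

variable {𝕏 : Type*} [MeasurableSpace 𝕏] {d : ℕ} {μ : Measure 𝕏} {f : (Fin d → ℝ) → 𝕏 → ℝ}
  {Θ C C' : Rect d} {p : Tuning d} {α Rlo Rhi η : Fin d → ℝ} {κ : ℝ} {k : Fin d}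
  {T : (Fin d → ℝ) → (Fin d → ℝ) → ℝ}

theorem Rect.IsSubrect.trans {A B D : Rect d} (h : A.IsSubrect B) (h' : B.IsSubrect D) :
    A.IsSubrect D := ⟨h.1, h.2.trans h'.2⟩

theorem Rect.center_mem (hC : C.lo ≤ C.hi) : C.center ∈ C.toSet :=
  ⟨fun j => by have := hC j; simp only [Rect.center]; linarith,
    fun j => by have := hC j; simp only [Rect.center]; linarith⟩

theorem IsSelected.lt (hp : p.Admissible μ f Θ α Rlo κ) (hα : ∀ j, 0 < α j)
    (hR : ∀ j, 0 < Rlo j) (hC : C.IsSubrect Θ) (hk : IsSelected α p C k)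
    (h : ∃ j, C.lo j < C.hi j) : C.lo k < C.hi k := by
  obtain ⟨j, hj⟩ := h
  refine lt_of_le_of_ne (hC.1 k) fun heq => ?_
  have h1 := hk j
  rw [heq, sub_self, Real.zero_rpow (hα k).ne', mul_zero] at h1
  have : 0 < p.Rloc C j * (C.hi j - C.lo j) ^ α j :=
    mul_pos ((hR j).trans_le (hp.le_Rloc C hC j)) (Real.rpow_pos_of_pos (sub_pos.2 hj) _)
  linarith

/-- The selected side of `C` controls its Hellinger diameter: two points of `C` are at most as
far from each other, up to the factor `ρ ≥ R̄_j / R̲_j`, as points of the faces orthogonal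
to `k`. -/
theorem IsSelected.hellingerSq_le (hp : p.Admissible μ f Θ α Rlo κ) (hα : ∀ j, 0 < α j)
    (hR : ∀ j, 0 < Rlo j) (hH : HolderHellinger μ f Θ α Rlo Rhi) {ρ : ℝ} (hρ0 : 0 ≤ ρ)
    (hρ : ∀ j, Rhi j ≤ ρ * Rlo j) (hC : C.IsSubrect Θ) (hk : IsSelected α p C k)
    {q q' θ θ' : Fin d → ℝ} (hq : q ∈ C.toSet) (hq' : q' ∈ C.toSet) (hθ : θ ∈ C.toSet)
    (hθ' : θ' ∈ C.toSet) (hlo : θ k = C.lo k) (hhi : θ' k = C.hi k) :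
    hellingerSq μ (f q) (f q') ≤ ρ * hellingerSq μ (f θ) (f θ') := by
  have : Nonempty (Fin d) := ⟨k⟩
  refine (hH q (hC.2 hq) q' (hC.2 hq')).2.trans (ciSup_le fun j => ?_)
  have h0 : 0 ≤ C.hi j - C.lo j := sub_nonneg.2 (hC.1 j)
  have h1 : |q j - q' j| ^ α j ≤ (C.hi j - C.lo j) ^ α j := by
    refine Real.rpow_le_rpow (abs_nonneg _) ?_ (hα j).le
    rw [abs_le]
    constructor <;> linarith [hq.1 j, hq.2 j, hq'.1 j, hq'.2 j]
  have h2 : p.Rloc C k * (C.hi k - C.lo k) ^ α k ≤ hellingerSq μ (f θ) (f θ') := by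
    refine le_trans ?_ (hp.Rloc_le C hC θ hθ θ' hθ')
    refine le_trans (le_of_eq ?_) (le_ciSup (f := fun j => p.Rloc C j * |θ j - θ' j| ^ α j)
      (Set.finite_range _).bddAbove k)
    rw [hlo, hhi, abs_sub_comm, abs_of_nonneg (sub_nonneg.2 (hC.1 k))]
  calc Rhi j * |q j - q' j| ^ α j
      ≤ (ρ * p.Rloc C j) * (C.hi j - C.lo j) ^ α j := by
        have h3 : Rhi j ≤ ρ * p.Rloc C j :=
          (hρ j).trans (mul_le_mul_of_nonneg_left (hp.le_Rloc C hC j) hρ0)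
        have h4 : 0 ≤ ρ * p.Rloc C j :=
          mul_nonneg hρ0 ((hR j).le.trans (hp.le_Rloc C hC j))
        exact (mul_le_mul_of_nonneg_right h3 (Real.rpow_nonneg (abs_nonneg _) _)).trans
          (mul_le_mul_of_nonneg_left h1 h4)
    _ = ρ * (p.Rloc C j * (C.hi j - C.lo j) ^ α j) := mul_assoc _ _ _
    _ ≤ ρ * hellingerSq μ (f θ) (f θ') := mul_le_mul_of_nonneg_left ((hk j).trans h2) hρ0

/-- A parameter `q` of `C` either survives until the end of the run or is discarded at a step where
the pair of points compared is at Hellinger distance at most `√B`; in both cases the output is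
close to `q`. -/
theorem RunReturns.hellingerSq_center_le (hp : p.Admissible μ f Θ α Rlo κ)
    (hα : ∀ j, 0 < α j) (hR : ∀ j, 0 < Rlo j) (hH : HolderHellinger μ f Θ α Rlo Rhi) {ρ : ℝ}
    (hρ0 : 0 ≤ ρ) (hρ : ∀ j, Rhi j ≤ ρ * Rlo j) (hη : ∀ j, 0 ≤ η j) {B D : ℝ}
    (hD : ∀ j, Rhi j * η j ^ α j ≤ D) (hd : Nonempty (Fin d)) (hRhi : ∀ j, 0 ≤ Rhi j)
    {q : Fin d → ℝ}
    (hB : ∀ θ ∈ Θ.toSet, ∀ θ' ∈ Θ.toSet,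
      ((0 ≤ T θ θ' ∧ hellinger μ (f θ) (f q) ≤ √κ * hellinger μ (f θ) (f θ')) ∨
        (T θ θ' ≤ 0 ∧ hellinger μ (f θ') (f q) ≤ √κ * hellinger μ (f θ') (f θ))) →
      hellingerSq μ (f θ) (f θ') ≤ B)
    (hrun : RunReturns T α η p C C') (hC : C.IsSubrect Θ) (hq : q ∈ C.toSet) :
    C'.IsSubrect C ∧ hellingerSq μ (f q) (f C'.center) ≤ max D (ρ * B) := by
  have hsub : ∀ {A A' : Rect d}, RunReturns T α η p A A' → A.IsSubrect Θ → A'.IsSubrect A := by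
    intro A A' h
    induction h with
    | finish C _ => exact fun hA => ⟨hA.1, subset_rfl⟩
    | step C C₁ C₂ k hlt hk hloop _ ih =>
      intro hA
      have hltk := hk.lt hp hα hR hA (hlt.imp fun j hj => by linarith [hη j])
      have h1 := (hloop.isSubrect_and_discardable hp hA hltk
        (loopInvariant_initState hp hA hltk _)).1
      exact (ih (h1.trans hA)).trans h1
  refine ⟨hsub hrun hC, ?_⟩
  induction hrun with
  | finish C h =>
    refine le_max_of_le_left ((hH q (hC.2 hq) _ (hC.2 (C.center_mem hC.1))).2.trans
      (ciSup_le fun j => ?_))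
    refine le_trans (mul_le_mul_of_nonneg_left (Real.rpow_le_rpow (abs_nonneg _) ?_ (hα j).le)
      (hRhi j)) (hD j)
    have h1 := C.center_mem hC.1
    rw [abs_le]
    constructor <;> linarith [hq.1 j, hq.2 j, h1.1 j, h1.2 j, h j]
  | step C C₁ C₂ k hlt hk hloop hrest ih =>
    have hltk := hk.lt hp hα hR hC (hlt.imp fun j hj => by linarith [hη j])
    have h1 := hloop.isSubrect_and_discardable hp hC hltk (loopInvariant_initState hp hC hltk _)
    by_cases hq1 : q ∈ C₁.toSet
    · exact ih (h1.1.trans hC) hq1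
    · obtain ⟨θ, hθ, θ', hθ', hlo, hhi, hT⟩ := h1.2 q hq hq1
      have hcen : C₂.center ∈ C.toSet := h1.1.2 ((hsub hrest (h1.1.trans hC)).2
        (C₂.center_mem (hsub hrest (h1.1.trans hC)).1))
      refine le_max_of_le_right ((hk.hellingerSq_le hp hα hR hH hρ0 hρ hC hq hcen hθ hθ' hlo
        hhi).trans (mul_le_mul_of_nonneg_left (hB θ (hC.2 hθ) θ' (hC.2 hθ') ?_) hρ0))
      exact hT.imp (fun h => ⟨h.1, h.2.2⟩) fun h => ⟨h.1, h.2.2⟩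

end Run

/-! ### From the test to a bound on the compared pair -/

/-- The condition `κ < κ̄` leaves room for a slack `δ` in the comparison of the risks. -/
theorem exists_slack {κ : ℝ} (hκ : κ ∈ Set.Ioo 0 kappaBar) :
    ∃ δ : ℝ, 0 < δ ∧ 0 < √2 - 1 - δ ∧
      √κ * (1 + √((√2 + 1 + δ) / (√2 - 1 - δ))) < 1 := by
  have hc : √2 ^ 2 = (2 : ℝ) := Real.sq_sqrt (by norm_num)
  have hc1 : 1 < √(2 : ℝ) := Real.lt_sqrt_of_sq_lt (by norm_num)
  have hratio : (2 + √2) / (2 - √2) = (√2 + 1 + 0) / (√2 - 1 - 0) := by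
    have h1 : 2 - √(2 : ℝ) ≠ 0 := by nlinarith
    have h2 : √(2 : ℝ) - 1 - 0 ≠ 0 := by linarith
    rw [div_eq_div_iff h1 h2]
    linear_combination hc * 2
  have h0 : √κ * (1 + √((√2 + 1 + 0) / (√2 - 1 - 0))) < 1 := by
    rw [← hratio]
    have hlt := hκ.2
    unfold kappaBar at hlt
    set Q := 1 + √((2 + √2) / (2 - √2))
    have hQ : 0 < Q := by positivity
    have h1 := Real.sqrt_lt_sqrt hκ.1.le hlt
    rw [← inv_pow, Real.sqrt_sq (inv_pos.2 hQ).le] at h1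
    calc √κ * Q < Q⁻¹ * Q := mul_lt_mul_of_pos_right h1 hQ
      _ = 1 := inv_mul_cancel₀ hQ.ne'
  have hcont : ContinuousAt
      (fun δ : ℝ => √κ * (1 + √((√2 + 1 + δ) / (√2 - 1 - δ)))) 0 := by
    have : √(2 : ℝ) - 1 - 0 ≠ 0 := by linarith
    fun_prop (disch := assumption)
  have h1 := hcont.eventually (gt_mem_nhds h0)
  have h2 : ∀ᶠ δ : ℝ in nhds 0, δ < √2 - 1 := gt_mem_nhds (by linarith)
  have h3 := ((h1.and h2).filter_mono nhdsWithin_le_nhds).and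
    (self_mem_nhdsWithin : Set.Ioi (0 : ℝ) ∈ nhdsWithin 0 (Set.Ioi 0))
  obtain ⟨δ, ⟨hδ1, hδ2⟩, hδ3⟩ := h3.exists
  exact ⟨δ, hδ3, by linarith, hδ1⟩

/-- Here `a, b, c, e, z` stand for the distances `h(s, f_θ)`, `h(s, f_θ')`, `h(f_θ, f_θ')`,
`h(f_θ, f_q)`, `h(s, f_q)` and `a', b'` for those from `s` to the discretised parameters. If
the test prefers `θ'` although `q` is close to `θ`, then `θ` and `θ'` are close to each other. -/
theorem dist_le_of_test {u v γ c₁ M a b c e z a' b' x : ℝ} (hu : 0 < u) (hv : 0 ≤ v)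
    (hM : 0 ≤ M) (ha' : 0 ≤ a') (hc₁ : 0 ≤ c₁)
    (hγ : γ * (1 + √(v / u)) < 1) (htri : c ≤ a + b) (haz : a ≤ z + e) (he : e ≤ γ * c)
    (haa : a' ≤ a + M) (hbb : b ≤ b' + M) (hz : z ≤ M) (hx : x ≤ c₁ * M ^ 2)
    (htest : u * b' ^ 2 ≤ v * a' ^ 2 + x) :
    c ≤ (2 * (1 + √(v / u)) + √(c₁ / u)) / (1 - γ * (1 + √(v / u))) * M := by
  have hQ0 : 0 ≤ √(v / u) := Real.sqrt_nonneg _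
  have hw0 : 0 ≤ √(c₁ / u) := Real.sqrt_nonneg _
  have hQ : √(v / u) ^ 2 = v / u := Real.sq_sqrt (by positivity)
  have hw : √(c₁ / u) ^ 2 = c₁ / u := Real.sq_sqrt (by positivity)
  generalize √(v / u) = Q at *
  generalize √(c₁ / u) = w at *
  have h1 : b' ≤ Q * a' + w * M := by
    refine abs_le_of_sq_le_sq' ?_ (by positivity) |>.2
    have h2 : b' ^ 2 ≤ v / u * a' ^ 2 + c₁ / u * M ^ 2 := by
      rw [div_mul_eq_mul_div, div_mul_eq_mul_div, ← add_div, le_div_iff₀ hu]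
      linarith
    rw [← hQ, ← hw] at h2
    nlinarith [mul_nonneg (mul_nonneg hQ0 ha') (mul_nonneg hw0 hM)]
  rw [div_mul_eq_mul_div, le_div_iff₀ (by linarith)]
  nlinarith [mul_le_mul_of_nonneg_left haa hQ0, mul_le_mul_of_nonneg_left haz hQ0,
    mul_le_mul_of_nonneg_left he hQ0, mul_le_mul_of_nonneg_left hz hQ0]

/-! ### The discretised parameters -/

section Grid

variable {𝕏 : Type*} [MeasurableSpace 𝕏] {d : ℕ} {μ : Measure 𝕏} {f : (Fin d → ℝ) → 𝕏 → ℝ}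
  {Θ : Rect d} {α Rlo Rhi ε t : Fin d → ℝ} {n : ℕ}

/-- The point of the grid of origin `m` and steps `ε` with integer coordinates `l`. -/
def gridPoint (m ε : Fin d → ℝ) (l : Fin d → ℤ) : Fin d → ℝ := fun j => m j + l j * ε j

/-- The integer coordinates of the points of the grid that lie in `Θ`, one side at a time. -/
noncomputable def gridRange (Θ : Rect d) (ε : Fin d → ℝ) (j : Fin d) : Finset ℤ :=
  Finset.Icc 0 ⌊(Θ.hi j - Θ.lo j) / ε j⌋

theorem gridPoint_mem (hε : ∀ j, 0 < ε j) {l : Fin d → ℤ}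
    (hl : l ∈ Fintype.piFinset (gridRange Θ ε)) : gridPoint Θ.lo ε l ∈ Θ.toSet := by
  have h : ∀ j, 0 ≤ l j ∧ l j ≤ ⌊(Θ.hi j - Θ.lo j) / ε j⌋ := fun j => by
    simpa [gridRange] using Fintype.mem_piFinset.1 hl j
  refine ⟨fun j => ?_, fun j => ?_⟩ <;> simp only [gridPoint]
  · have : (0 : ℝ) ≤ l j := by exact_mod_cast (h j).1
    nlinarith [hε j]
  · have h1 : (l j : ℝ) ≤ (Θ.hi j - Θ.lo j) / ε j := Int.le_floor.1 (h j).2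
    rw [le_div_iff₀ (hε j)] at h1
    linarith

theorem exists_gridProj_eq (hε : ∀ j, 0 < ε j) {θ : Fin d → ℝ} (hθ : θ ∈ Θ.toSet) :
    ∃ l ∈ Fintype.piFinset (gridRange Θ ε), gridProj Θ.lo ε θ = gridPoint Θ.lo ε l := by
  refine ⟨fun j => ⌊(θ j - Θ.lo j) / ε j⌋, Fintype.mem_piFinset.2 fun j => ?_, rfl⟩
  rw [gridRange, Finset.mem_Icc]
  refine ⟨Int.floor_nonneg.2 (div_nonneg (sub_nonneg.2 (hθ.1 j)) (hε j).le),
    Int.floor_le_floor (div_le_div_of_nonneg_right ?_ (hε j).le)⟩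
  linarith [hθ.2 j]

theorem abs_sub_gridProj_le (hε : ∀ j, 0 < ε j) (m θ : Fin d → ℝ) (j : Fin d) :
    |θ j - gridProj m ε θ j| ≤ ε j := by
  have h1 := Int.floor_le ((θ j - m j) / ε j)
  have h2 := Int.lt_floor_add_one ((θ j - m j) / ε j)
  rw [le_div_iff₀ (hε j)] at h1
  rw [div_lt_iff₀ (hε j)] at h2
  simp only [gridProj]
  rw [abs_le]
  constructor <;> nlinarith [hε j]

theorem mul_rpow_neg_inv_rpow {t R α : ℝ} (ht : 0 ≤ t) (hR : 0 ≤ R) (hα : 0 < α) :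
    (t * R ^ (-(1 / α))) ^ α = t ^ α * R⁻¹ := by
  rw [Real.mul_rpow ht (Real.rpow_nonneg hR _), ← Real.rpow_mul hR]
  congr 1
  rw [show -(1 / α) * α = -1 by field_simp, Real.rpow_neg_one]

theorem rpow_inv_rpow_self {D α : ℝ} (hD : 0 ≤ D) (hα : 0 < α) : (D ^ (1 / α)) ^ α = D := by
  rw [← Real.rpow_mul hD, one_div_mul_cancel hα.ne', Real.rpow_one]

/-- Side lengths at most `d^{1/α_j} (R̄_j n)^{-1/α_j}` correspond to squared Hellinger distances at
most `d / n`. -/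
theorem mul_rpow_le_div {D N R α e : ℝ} (hD : 0 ≤ D) (hN : 0 < N) (hR : 0 < R) (hα : 0 < α)
    (he0 : 0 ≤ e) (he : e ≤ D ^ (1 / α) * (R * N) ^ (-(1 / α))) : R * e ^ α ≤ D / N := by
  have h := Real.rpow_le_rpow he0 he hα.le
  rw [mul_rpow_neg_inv_rpow (Real.rpow_nonneg hD _) (by positivity) hα,
    rpow_inv_rpow_self hD hα] at h
  calc R * e ^ α ≤ R * (D * (R * N)⁻¹) := mul_le_mul_of_nonneg_left h hR.le
    _ = D / N := by field_simp

theorem hellingerSq_gridProj_le (hd : 1 ≤ d) (hα : ∀ j, 0 < α j) (hRhi : ∀ j, 0 < Rhi j)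
    (hH : HolderHellinger μ f Θ α Rlo Rhi) (hn : 1 ≤ n) (hε : ∀ j, 0 < ε j)
    (hεle : ∀ j, ε j ≤ (d : ℝ) ^ (1 / α j) * (Rhi j * n) ^ (-(1 / α j)))
    {θ : Fin d → ℝ} (hθ : θ ∈ Θ.toSet) :
    hellingerSq μ (f θ) (f (gridProj Θ.lo ε θ)) ≤ d / n := by
  have : Nonempty (Fin d) := ⟨⟨0, hd⟩⟩
  obtain ⟨l, hl, hle⟩ := exists_gridProj_eq hε hθ
  refine (hH θ hθ _ (hle ▸ gridPoint_mem hε hl)).2.trans (ciSup_le fun j => ?_)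
  exact (mul_le_mul_of_nonneg_left (Real.rpow_le_rpow (abs_nonneg _)
    (abs_sub_gridProj_le hε _ _ j) (hα j).le) (hRhi j).le).trans
    (mul_rpow_le_div (Nat.cast_nonneg d) (by exact_mod_cast hn) (hRhi j) (hα j) (hε j).le (hεle j))

theorem le_hellingerSq_gridPoint (hα : ∀ j, 0 < α j) (hRhi : ∀ j, 0 < Rhi j)
    (hH : HolderHellinger μ f Θ α Rlo Rhi) (ht : ∀ j, 0 < t j)
    (hε : ∀ j, 0 < ε j) (hεeq : ∀ j, ε j = t j * (Rhi j * n) ^ (-(1 / α j))) {l l₀ : Fin d → ℤ}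
    (hl : l ∈ Fintype.piFinset (gridRange Θ ε)) (hl₀ : l₀ ∈ Fintype.piFinset (gridRange Θ ε))
    (j : Fin d) :
    Rlo j * (t j ^ α j * (Rhi j * n)⁻¹) * |((l j - l₀ j : ℤ) : ℝ)| ^ α j
      ≤ hellingerSq μ (f (gridPoint Θ.lo ε l)) (f (gridPoint Θ.lo ε l₀)) := by
  refine le_trans (le_of_eq ?_) ((le_ciSup (f := fun j => Rlo j
    * |gridPoint Θ.lo ε l j - gridPoint Θ.lo ε l₀ j| ^ α j) (Set.finite_range _).bddAbove
    j).trans (hH _ (gridPoint_mem hε hl) _ (gridPoint_mem hε hl₀)).1)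
  have h : gridPoint Θ.lo ε l j - gridPoint Θ.lo ε l₀ j = ε j * ((l j - l₀ j : ℤ) : ℝ) := by
    simp only [gridPoint]
    push_cast
    ring
  have h2 : ε j ^ α j = t j ^ α j * (Rhi j * n)⁻¹ := by
    rw [hεeq j]
    exact mul_rpow_neg_inv_rpow (ht j).le
      (mul_nonneg (hRhi j).le (Nat.cast_nonneg n)) (hα j)
  simp only [h]
  rw [abs_mul, abs_of_pos (hε j), Real.mul_rpow (hε j).le (abs_nonneg _), h2]
  ring

end Grid

/-! ### The risk of the estimator -/

section Risk

variable {𝕏 : Type*} [MeasurableSpace 𝕏] {d n : ℕ} {μ : Measure 𝕏} {f : (Fin d → ℝ) → 𝕏 → ℝ}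
  {Θ : Rect d} {α Rlo Rhi ε η : Fin d → ℝ} {s : 𝕏 → ℝ} {p : Tuning d} {κ : ℝ}

theorem exists_hellingerSq_le_model {b : ℝ} (hb : 0 < b) (hΘ : Θ.lo ≤ Θ.hi) :
    ∃ q ∈ Θ.toSet, hellingerSq μ s (f q) ≤ hellingerSqModel μ s f Θ + b := by
  have hne : ((fun θ => hellingerSq μ s (f θ)) '' Θ.toSet).Nonempty :=
    ⟨_, Set.mem_image_of_mem _ (⟨le_rfl, hΘ⟩ : Θ.lo ∈ Θ.toSet)⟩
  obtain ⟨_, ⟨q, hq, rfl⟩, hlt⟩ := exists_lt_of_csInf_lt hne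
    (lt_add_of_pos_right (hellingerSqModel μ s f Θ) hb)
  exact ⟨q, hq, hlt.le⟩

theorem hellingerSqModel_nonneg : 0 ≤ hellingerSqModel μ s f Θ :=
  Real.sInf_nonneg (by rintro _ ⟨q, -, rfl⟩; exact hellingerSq_nonneg)

/-- On the event that the test never errs by more than `c₁ M²` on the grid, a comparison
that is not won by the point close to `q` involves points at distance `O(M)`. -/
theorem hellinger_le_of_test_nonneg (hd : 1 ≤ d) (hα : ∀ j, 0 < α j) (hRhi : ∀ j, 0 < Rhi j)
    (hH : HolderHellinger μ f Θ α Rlo Rhi) (hn : 1 ≤ n) (hε : ∀ j, 0 < ε j)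
    (hεle : ∀ j, ε j ≤ (d : ℝ) ^ (1 / α j) * (Rhi j * n) ^ (-(1 / α j)))
    (hf : ∀ θ ∈ Θ.toSet, IsDensity μ (f θ)) (hs : IsDensity μ s) {u v c₁ M x : ℝ} (hu : 0 < u)
    (hv : 0 ≤ v) (hM : 0 ≤ M) (hc₁ : 0 ≤ c₁) (hκ : √κ * (1 + √(v / u)) < 1)
    (hx : x ≤ c₁ * M ^ 2) (hdM : (d : ℝ) / n ≤ M ^ 2) {X : Fin n → 𝕏}
    (hgood : ∀ l ∈ Fintype.piFinset (gridRange Θ ε), ∀ l' ∈ Fintype.piFinset (gridRange Θ ε),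
      testFunctional μ X (f (gridPoint Θ.lo ε l)) (f (gridPoint Θ.lo ε l'))
        < v * hellingerSq μ s (f (gridPoint Θ.lo ε l))
          - u * hellingerSq μ s (f (gridPoint Θ.lo ε l')) + x)
    {q θ θ' : Fin d → ℝ} (hq : q ∈ Θ.toSet) (hqM : hellinger μ s (f q) ≤ M) (hθ : θ ∈ Θ.toSet)
    (hθ' : θ' ∈ Θ.toSet) (hT : 0 ≤ test μ f Θ ε X θ θ')
    (hball : hellinger μ (f θ) (f q) ≤ √κ * hellinger μ (f θ) (f θ')) :
    hellinger μ (f θ) (f θ')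
      ≤ (2 * (1 + √(v / u)) + √(c₁ / u)) / (1 - √κ * (1 + √(v / u))) * M := by
  have hproj : ∀ {θ}, θ ∈ Θ.toSet →
      IsDensity μ (f (gridProj Θ.lo ε θ)) ∧ hellinger μ (f θ) (f (gridProj Θ.lo ε θ)) ≤ M := by
    intro θ hθ
    obtain ⟨l, hl, hle⟩ := exists_gridProj_eq hε hθ
    refine ⟨hle ▸ hf _ (gridPoint_mem hε hl), ?_⟩
    rw [hellinger, Real.sqrt_le_left hM]
    exact (hellingerSq_gridProj_le hd hα hRhi hH hn hε hεle hθ).trans hdM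
  obtain ⟨l, hl, hle⟩ := exists_gridProj_eq hε hθ
  obtain ⟨l', hl', hle'⟩ := exists_gridProj_eq hε hθ'
  have htest := hgood l hl l' hl'
  rw [← hle, ← hle', ← sq_hellinger, ← sq_hellinger] at htest
  unfold test at hT
  have h1 := hellinger_triangle (hf θ hθ) hs (hf θ' hθ')
  rw [hellinger_comm (f := f θ) (g := s)] at h1
  have h2 := hellinger_triangle hs (hf q hq) (hf θ hθ)
  rw [hellinger_comm (f := f q)] at h2
  have h3 := hellinger_triangle hs (hf θ hθ) (hproj hθ).1
  have h4 := hellinger_triangle hs (hproj hθ').1 (hf θ' hθ')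
  rw [hellinger_comm (f := f (gridProj Θ.lo ε θ'))] at h4
  exact dist_le_of_test (a' := hellinger μ s (f (gridProj Θ.lo ε θ)))
    (b' := hellinger μ s (f (gridProj Θ.lo ε θ'))) hu hv hM hellinger_nonneg hc₁ hκ h1 h2 hball
    (h3.trans (by linarith [(hproj hθ).2])) (h4.trans (by linarith [(hproj hθ').2])) hqM hx
    (by linarith)

/-- The deterministic half of the theorem: on the event that the test never errs by more than
`c₁ M²` on the grid, every output of the procedure has risk `O(M²)`. -/
theorem IsEstimate.hellinger_le (hd : 1 ≤ d) (hα : ∀ j, 0 < α j) (hRlo : ∀ j, 0 < Rlo j)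
    (hRhi : ∀ j, 0 < Rhi j) {ρ : ℝ} (hρ0 : 0 ≤ ρ) (hρ : ∀ j, Rhi j ≤ ρ * Rlo j)
    (hH : HolderHellinger μ f Θ α Rlo Rhi) (hn : 1 ≤ n) (hε : ∀ j, 0 < ε j)
    (hεη : ∀ j, ε j ≤ η j)
    (hηle : ∀ j, η j ≤ (d : ℝ) ^ (1 / α j) * (Rhi j * n) ^ (-(1 / α j)))
    (hΘ : Θ.lo ≤ Θ.hi) (hf : ∀ θ ∈ Θ.toSet, IsDensity μ (f θ)) (hs : IsDensity μ s)
    (hp : p.Admissible μ f Θ α Rlo κ) {u v c₁ M x : ℝ} (hu : 0 < u)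
    (hv : 0 ≤ v) (hM : 0 ≤ M) (hc₁ : 0 ≤ c₁) (hκ : √κ * (1 + √(v / u)) < 1)
    (hx : x ≤ c₁ * M ^ 2) (hdM : (d : ℝ) / n ≤ M ^ 2) {X : Fin n → 𝕏}
    (hgood : ∀ l ∈ Fintype.piFinset (gridRange Θ ε), ∀ l' ∈ Fintype.piFinset (gridRange Θ ε),
      testFunctional μ X (f (gridPoint Θ.lo ε l)) (f (gridPoint Θ.lo ε l'))
        < v * hellingerSq μ s (f (gridPoint Θ.lo ε l))
          - u * hellingerSq μ s (f (gridPoint Θ.lo ε l')) + x)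
    {q : Fin d → ℝ} (hq : q ∈ Θ.toSet) (hqM : hellinger μ s (f q) ≤ M) {θhat : Fin d → ℝ}
    (hest : IsEstimate μ f Θ ε α η p X θhat) :
    hellinger μ s (f θhat) ≤ (1 + √(1 + ρ *
      ((2 * (1 + √(v / u)) + √(c₁ / u)) / (1 - √κ * (1 + √(v / u)))) ^ 2)) * M := by
  have hεle := fun j => (hεη j).trans (hηle j)
  have key := fun {θ θ' : Fin d → ℝ} => hellinger_le_of_test_nonneg (θ := θ) (θ' := θ') hd hα hRhi
    hH hn hε hεle hf hs hu hv hM hc₁ hκ hx hdM hgood hq hqM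
  generalize (2 * (1 + √(v / u)) + √(c₁ / u)) / (1 - √κ * (1 + √(v / u))) = K at key ⊢
  obtain ⟨C, hrun, rfl⟩ := hest
  have hη0 : ∀ j, 0 ≤ η j := fun j => (hε j).le.trans (hεη j)
  have h := hrun.hellingerSq_center_le hp hα hRlo hH hρ0 hρ hη0
    (B := (K * M) ^ 2) (D := (d : ℝ) / n)
    (fun j => mul_rpow_le_div (Nat.cast_nonneg d) (by exact_mod_cast hn) (hRhi j) (hα j)
      (hη0 j) (hηle j)) ⟨⟨0, hd⟩⟩ (fun j => (hRhi j).le) (q := q) ?_ ⟨hΘ, subset_rfl⟩ hq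
  · have hC : C.center ∈ Θ.toSet := h.1.2 (C.center_mem h.1.1)
    have h2 : hellinger μ (f q) (f C.center) ≤ √(1 + ρ * K ^ 2) * M := by
      rw [hellinger]
      refine Real.sqrt_le_iff.2 ⟨by positivity, h.2.trans ?_⟩
      rw [mul_pow √(1 + ρ * K ^ 2) M 2, Real.sq_sqrt (by positivity)]
      have : 0 ≤ ρ * K ^ 2 * M ^ 2 := by positivity
      refine max_le ?_ ?_ <;> nlinarith [sq_nonneg M]
    have h3 := hellinger_triangle hs (hf q hq) (hf _ hC)
    linarith
  · rintro θ hθ θ' hθ' (⟨hT, hball⟩ | ⟨hT, hball⟩)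
    · rw [← sq_hellinger]
      exact pow_le_pow_left₀ hellinger_nonneg (key hθ hθ' hT hball) 2
    · have hT' : 0 ≤ test μ f Θ ε X θ' θ := by
        unfold test at hT ⊢
        rw [testFunctional_swap]
        exact neg_nonneg.2 hT
      rw [hellingerSq_comm, ← sq_hellinger]
      exact pow_le_pow_left₀ hellinger_nonneg (key hθ' hθ hT' hball) 2

end Risk

end RobustTests

theorem theorem3 (d : ℕ) (hd : 1 ≤ d) (κ : ℝ) (hκ : κ ∈ Set.Ioo 0 kappaBar)
    (ρ α t : Fin d → ℝ) (hρ : ∀ j, 0 < ρ j) (hα : ∀ j, 0 < α j)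
    (ht : ∀ j, t j ∈ Set.Ioc 0 ((d : ℝ) ^ (1 / α j))) :
    ∃ C : ℝ, 0 < C ∧
      ∀ (Ω 𝕏 : Type*) [MeasurableSpace Ω] [MeasurableSpace 𝕏]
        (P : Measure Ω) [IsProbabilityMeasure P] (μ : Measure 𝕏)
        -- the model
        (Θ : Rect d) (_ : Θ.lo ≤ Θ.hi) (f : (Fin d → ℝ) → 𝕏 → ℝ)
        (_ : ∀ θ ∈ Θ.toSet, IsDensity μ (f θ))
        (Rlo Rhi : Fin d → ℝ) (_ : ∀ j, 0 < Rlo j) (_ : ∀ j, 0 < Rhi j)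
        (_ : ∀ j, Rhi j / Rlo j = ρ j) (_ : HolderHellinger μ f Θ α Rlo Rhi)
        -- the observations
        (n : ℕ) (_ : 1 ≤ n) (s : 𝕏 → ℝ) (_ : IsDensity μ s)
        (X : Fin n → Ω → 𝕏) (_ : ∀ i, Measurable (X i)) (_ : iIndepFun X P)
        (_ : ∀ i, P.map (X i) = μ.withDensity (fun x => ENNReal.ofReal (s x)))
        -- the parameters of the procedure
        (ε η : Fin d → ℝ) (_ : ∀ j, ε j = t j * (Rhi j * n) ^ (-(1 / α j)))
        (_ : ∀ j, η j ∈ Set.Icc (ε j) ((d : ℝ) ^ (1 / α j) * (Rhi j * n) ^ (-(1 / α j))))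
        (p : Tuning d) (_ : p.Admissible μ f Θ α Rlo κ)
        (ξ : ℝ) (_ : 0 < ξ),
        P {ω | ∃ θhat, IsEstimate μ f Θ ε α η p (fun i => X i ω) θhat ∧
            C * hellingerSq μ s (f θhat) ≥ hellingerSqModel μ s f Θ + d / n + ξ}
          ≤ ENNReal.ofReal (Real.exp (-(n * ξ))) := by
  obtain ⟨δ, hδ, hu, hγ⟩ := exists_slack hκ
  have hd0 : (0 : ℝ) < d := by exact_mod_cast hd
  have hδ1 : δ ≤ 1 := by
    nlinarith [Real.sq_sqrt (show (0 : ℝ) ≤ 2 by norm_num), Real.sqrt_nonneg (2 : ℝ)]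
  have hv : 0 ≤ √2 + 1 + δ := by positivity
  -- the rates at which the weights of the grid points decay
  set c : Fin d → ℝ := fun j => δ / 12 * δ / 4 / d * (t j ^ α j / ρ j) with hcdef
  have hc : ∀ j, 0 < c j := fun j =>
    mul_pos (by positivity) (div_pos (Real.rpow_pos_of_pos (ht j).1 _) (hρ j))
  have hA0 := latticeSum_pos hc hα
  set A := latticeSum c α
  set L := |Real.log A|
  have hAL : A ≤ Real.exp L := by
    rw [← Real.log_le_iff_le_exp hA0]
    exact le_abs_self _
  have hL : 0 ≤ L := abs_nonneg _
  set c₁ := 12 / δ + 4 * δ + 24 * L / δ with hc₁def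
  have hc₁ : 0 ≤ c₁ := by positivity
  set C₀ := 1 + √(1 + (∑ j, ρ j) * ((2 * (1 + √((√2 + 1 + δ) / (√2 - 1 - δ)))
    + √(c₁ / (√2 - 1 - δ))) / (1 - √κ * (1 + √((√2 + 1 + δ) / (√2 - 1 - δ))))) ^ 2)
  have hC₀ : 0 < C₀ := by positivity
  refine ⟨1 / (2 * C₀ ^ 2), by positivity, ?_⟩
  intro Ω 𝕏 _ _ P _ μ Θ hΘ f hf Rlo Rhi hRlo hRhi hratio hH n hn s hs X hX hind hmap ε η hεeq hη p
    hp ξ hξ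
  have hn0 : (0 : ℝ) < n := by exact_mod_cast hn
  have hε : ∀ j, 0 < ε j := fun j => by
    rw [hεeq j]
    exact mul_pos (ht j).1 (Real.rpow_pos_of_pos (mul_pos (hRhi j) hn0) _)
  have hηle := fun j => (hη j).2
  have hεle := fun j => (hη j).1.trans (hηle j)
  have hdn : 0 < (d : ℝ) / n := by positivity
  obtain ⟨q, hq, hqle⟩ := exists_hellingerSq_le_model (μ := μ) (s := s) (f := f) hdn hΘ
  have hmod := hellingerSqModel_nonneg (μ := μ) (s := s) (f := f) (Θ := Θ)
  set N := hellingerSqModel μ s f Θ + d / n + ξ with hNdef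
  have hN : 0 < N := by positivity
  have hM2 : √N ^ 2 = N := Real.sq_sqrt hN.le
  have hqM : hellinger μ s (f q) ≤ √N := Real.sqrt_le_sqrt (by linarith)
  obtain ⟨l₀, hl₀, hq₀⟩ := exists_gridProj_eq hε hq
  have hg₀ := hf _ (gridPoint_mem hε hl₀)
  -- the centre of the family of weights is the discretisation of the near-minimiser `q`
  have hh₀ : hellingerSq μ s (f (gridPoint Θ.lo ε l₀)) ≤ 4 * N := by
    have h1 := hellinger_triangle hs (hf q hq) hg₀
    have h2 : hellinger μ (f q) (f (gridPoint Θ.lo ε l₀)) ≤ √N := by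
      rw [← hq₀]
      exact Real.sqrt_le_sqrt ((hellingerSq_gridProj_le hd hα hRhi hH hn hε hεle hq).trans
        (by linarith))
    rw [← sq_hellinger]
    nlinarith [hellinger_nonneg (μ := μ) (f := s) (g := f (gridPoint Θ.lo ε l₀))]
  set h₀ := hellingerSq μ s (f (gridPoint Θ.lo ε l₀))
  -- the level of the deviation for which the uniform bound is `exp (-n ξ)`
  set x := 12 / δ * ξ + δ * h₀ + 24 * L / δ * (1 / n) with hxdef
  have hx : x ≤ c₁ * √N ^ 2 := by
    rw [hM2]
    have h1 : 1 / (n : ℝ) ≤ N := by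
      have : 1 / (n : ℝ) ≤ d / n := div_le_div_of_nonneg_right (by exact_mod_cast hd) hn0.le
      linarith
    have h2 := mul_le_mul_of_nonneg_left h1 (show 0 ≤ 24 * L / δ by positivity)
    have h3 := mul_le_mul_of_nonneg_left (show ξ ≤ N by linarith) (show 0 ≤ 12 / δ by positivity)
    have h4 := mul_le_mul_of_nonneg_left hh₀ hδ.le
    rw [hxdef, hc₁def]
    nlinarith
  have hsum : ∑ l ∈ Fintype.piFinset (gridRange Θ ε), Real.exp (-(n * (δ / 12) * δ / 4
      * hellingerSq μ (f (gridPoint Θ.lo ε l)) (f (gridPoint Θ.lo ε l₀)))) ≤ A := by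
    refine sum_exp_neg_le_latticeSum hd hc hα _ l₀ _ fun l hl j => ?_
    refine le_trans (le_of_eq ?_) (mul_le_mul_of_nonneg_left (le_hellingerSq_gridPoint hα hRhi hH
      (fun j => (ht j).1) hε hεeq hl hl₀ j) (by positivity))
    have h1 := (hRlo j).ne'
    have h2 := (hRhi j).ne'
    simp only [hcdef]
    rw [← hratio j]
    field_simp
  refine (measure_mono fun ω hω => ?_).trans ((measure_exists_test_ge_le hn hs hX hind hmap
    (Fintype.piFinset (gridRange Θ ε)) (fun l => f (gridPoint Θ.lo ε l))
    (fun l hl => hf _ (gridPoint_mem hε hl)) hg₀ hδ.le hδ1 hsum x).trans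
    (ENNReal.ofReal_le_ofReal ?_))
  · obtain ⟨θhat, hest, hge⟩ := hω
    by_contra hgood
    simp only [Set.mem_ofPred_eq, not_exists, not_and, not_le] at hgood
    have hle := hest.hellinger_le hd hα hRlo hRhi (ρ := ∑ j, ρ j)
      (Finset.sum_nonneg fun j _ => (hρ j).le) (fun j => ?_) hH hn hε (fun j => (hη j).1) hηle hΘ hf
      hs hp hu hv (Real.sqrt_nonneg N) hc₁ hγ hx (by rw [hM2]; linarith) hgood hq hqM
    · have h1 := pow_le_pow_left₀ hellinger_nonneg hle 2
      rw [sq_hellinger, mul_pow, hM2] at h1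
      have h2 : 1 / (2 * C₀ ^ 2) * hellingerSq μ s (f θhat) ≤ N / 2 := by
        rw [div_mul_eq_mul_div, one_mul, div_le_div_iff₀ (by positivity) (by norm_num)]
        linarith
      linarith
    · have h1 := Finset.single_le_sum (fun i _ => (hρ i).le) (Finset.mem_univ j)
      have h2 : Rhi j = ρ j * Rlo j := by rw [← hratio j, div_mul_cancel₀ _ (hRlo j).ne']
      rw [h2]
      exact mul_le_mul_of_nonneg_right h1 (hRlo j).le
  · calc A ^ 2 * Real.exp (n * (δ / 12) * (δ * h₀ - x))
        ≤ Real.exp L ^ 2 * Real.exp (n * (δ / 12) * (δ * h₀ - x)) :=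
          mul_le_mul_of_nonneg_right (pow_le_pow_left₀ hA0.le hAL 2) (Real.exp_pos _).le
      _ = Real.exp (-(n * ξ)) := by
          rw [← Real.exp_nat_mul, ← Real.exp_add]
          congr 1
          rw [hxdef]
          push_cast
          field_simp
          ring
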